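/- Let $(M,\mathcal C)$ be a model of Morse–Kelley class theory (MK), where $M$ is a transitive set, every element of $\mathcal C$ is a subset of $M$, and membership is the true $\in$. Let $P\in\mathcal C$ be partially ordered by $\leq\;\in\mathcal C$, with a greatest element. Call $D\subseteq P$ dense if every $p\in P$ has some $d\le p$ in $D$, and dense below $p$ if for every $q\leq p$ there is $r\leq q$ with $r\in D$. A set $G\subseteq P$ is $P$-generic over $(M,\mathcal C)$ if any two elements of $G$ have a common lower bound in $P$, $G$ is upward closed, and $G$ meets every dense $D\subseteq P$ with $D\in\mathcal C$. Names: $\mathcal N^s_0=\emptyset$, $\mathcal N^s_{\alpha+1}=\{\sigma\in M:\sigma\subseteq\mathcal N^s_\alpha\times P\}$, $\mathcal N^s_\lambda=\bigcup_{\alpha<\lambda}\mathcal N^s_\alpha$ for limit $\lambda$; $\mathcal N^s=\bigcup_{\alpha\in \mathrm{Ord}(M)}\mathcal N^s_\alpha$ is the class of set-names and $\mathcal N=\{\Sigma\in\mathcal C:\Sigma\subseteq\mathcal N^s\times P\}$ the family of class-names. Put $\Sigma^G=\{\tau^G:\exists p\in G\ \langle\tau,p\rangle\in\Sigma\}$ (recursively)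 and $(M,\mathcal C)[G]=(\{\sigma^G:\sigma\in\mathcal N^s\},\{\Sigma^G:\Sigma\in\mathcal N\})$. Formulas are those of the two-sorted language with set variables $x$ and class variables $X$, atomic formulas $s\in t$ and $s=t$ for variables $s,t$ of either sort, closed under $\neg$, $\wedge$, $\forall x$ and $\forall X$ (other connectives are abbreviations; $\varphi\leftrightarrow\psi$ is $\neg(\varphi\wedge\neg\psi)\wedge\neg(\psi\wedge\neg\varphi)$). The relation $p\Vdash^*\varphi$ for $p\in P$ is defined recursively, for arbitrary (set- or class-) names $\Sigma,\Gamma$, by: - $p\Vdash^*\Sigma\in\Gamma$ iff $\{q:\exists\langle\pi,r\rangle\in\Gamma\ (q\leq r\text{ and }q\Vdash^*\pi=\Sigma)\}$ is dense below $p$; - $p\Vdash^*\Sigma=\Gamma$ iff $p\Vdash^*(\pi\in\Sigma\leftrightarrow\pi\in\Gamma)$ for all $\langle\pi,r\rangle\in\Sigma\cup\Gamma$; - $p\Vdash^*\varphi\wedge\psi$ iff $p\Vdash^*\varphi$ and $p\Vdash^*\psi$; - $p\Vdash^*\neg\varphi$ iff there is no $q\leq p$ with $q\Vdash^*\varphi$;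 - $p\Vdash^*\forall x\,\varphi$ iff $p\Vdash^*\varphi(\sigma)$ for all $\sigma\in\mathcal N^s$; - $p\Vdash^*\forall X\,\varphi$ iff $p\Vdash^*\varphi(\Sigma)$ for all $\Sigma\in\mathcal N$. Truth Lemma for $\Vdash^*$: if $G$ is $P$-generic over $(M,\mathcal C)$, then for every formula $\varphi(x_1,\dots,x_n,X_1,\dots,X_m)$, all set-names $\sigma_1,\dots,\sigma_n\in\mathcal N^s$ and all class-names $\Sigma_1,\dots,\Sigma_m\in\mathcal N$, $$(M,\mathcal C)[G]\models\varphi(\sigma_1^G,\dots,\sigma_n^G,\Sigma_1^G,\dots,\Sigma_m^G)\iff\exists p\in G\ \bigl(p\Vdash^*\varphi(\sigma_1,\dots,\sigma_n,\Sigma_1,\dots,\Sigma_m)\bigr).$$ -/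

import Mathlib

namespace MKForcing

universe u

/-! ### Two-sorted second-order formulas -/

/-- Formulas of the language of class theory with set variables `x₀, …, xₙ₋₁` and class variables
`X₀, …, Xₘ₋₁` free. A term is a variable of either sort; the atomic formulas are `s ∈ t` and
`s = t`. The primitive connectives are `¬`, `∧` and the universal quantifiers over sets and over
classes. A quantifier binds the variable with index `0` of its sort and shifts the others. -/
inductive Formula : ℕ → ℕ → Type
  | mem {n m : ℕ} (s t : Fin n ⊕ Fin m) : Formula n m
  | eq {n m : ℕ} (s t : Fin n ⊕ Fin m) : Formula n m
  | neg {n m : ℕ} (φ : Formula n m) : Formula n m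
  | and {n m : ℕ} (φ ψ : Formula n m) : Formula n m
  | allSet {n m : ℕ} (φ : Formula (n + 1) m) : Formula n m
  | allClass {n m : ℕ} (φ : Formula n (m + 1)) : Formula n m

/-- A structure for the language of class theory with the true `∈`: a family of sets and a family
of classes. Here the "classes" are again sets of the surrounding universe. -/
structure ClassModel where
  /-- the sets of the structure -/
  sets : Set ZFSet.{u}
  /-- the classes of the structure -/
  classes : Set ZFSet.{u}

/-- Satisfaction `𝓜 ⊨ φ(x₀, …, xₙ₋₁, X₀, …, Xₘ₋₁)`. -/
def ClassModel.Sat (𝓜 : ClassModel.{u}) :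
    {n m : ℕ} → Formula n m → (Fin n → ZFSet.{u}) → (Fin m → ZFSet.{u}) → Prop
  | _, _, .mem s t, x, X => Sum.elim x X s ∈ Sum.elim x X t
  | _, _, .eq s t, x, X => Sum.elim x X s = Sum.elim x X t
  | _, _, .neg φ, x, X => ¬ 𝓜.Sat φ x X
  | _, _, .and φ ψ, x, X => 𝓜.Sat φ x X ∧ 𝓜.Sat ψ x X
  | _, _, .allSet φ, x, X => ∀ a ∈ 𝓜.sets, 𝓜.Sat φ (Fin.cons a x) X
  | _, _, .allClass φ, x, X => ∀ A ∈ 𝓜.classes, 𝓜.Sat φ x (Fin.cons A X)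

/-! ### Models of Morse–Kelley class theory -/

/-- `F` is a function, i.e. a single-valued collection of ordered pairs. -/
def IsFunctionClass (F : ZFSet.{u}) : Prop :=
  (∀ z ∈ F, ∃ x y, z = ZFSet.pair x y) ∧
    ∀ x y y', ZFSet.pair x y ∈ F → ZFSet.pair x y' ∈ F → y = y'

/-- `𝓜 = (M, 𝒞)` is a transitive model of Morse–Kelley class theory: `M` is transitive, every
class is a subset of `M`, and the axioms of MK hold in `(M, ∈, 𝒞)`. -/
structure ClassModel.IsMK (𝓜 : ClassModel.{u}) : Prop where
  transitive : ∀ x ∈ 𝓜.sets, ∀ y ∈ x, y ∈ 𝓜.sets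
  classes_subset : ∀ X ∈ 𝓜.classes, ∀ x ∈ X, x ∈ 𝓜.sets
  set_extensionality : ∀ x ∈ 𝓜.sets, ∀ y ∈ 𝓜.sets,
    (∀ z ∈ 𝓜.sets, z ∈ x ↔ z ∈ y) → x = y
  pairing : ∀ x ∈ 𝓜.sets, ∀ y ∈ 𝓜.sets, ∃ z ∈ 𝓜.sets,
    ∀ w ∈ 𝓜.sets, w ∈ z ↔ w = x ∨ w = y
  infinity : ∃ w ∈ 𝓜.sets, ∅ ∈ w ∧ ∀ x ∈ w, insert x x ∈ w
  union : ∀ x ∈ 𝓜.sets, ∃ y ∈ 𝓜.sets, ∀ z ∈ 𝓜.sets, z ∈ y ↔ ∃ w ∈ x, z ∈ w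
  power_set : ∀ x ∈ 𝓜.sets, ∃ y ∈ 𝓜.sets, ∀ z ∈ 𝓜.sets, z ∈ y ↔ ∀ w ∈ z, w ∈ x
  foundation : ∀ X ∈ 𝓜.classes, (∃ x, x ∈ X) → ∃ x ∈ X, ∀ y ∈ X, y ∉ x
  class_extensionality : ∀ X ∈ 𝓜.classes, ∀ Y ∈ 𝓜.classes,
    (∀ z ∈ 𝓜.sets, z ∈ X ↔ z ∈ Y) → X = Y
  replacement : ∀ F ∈ 𝓜.classes, IsFunctionClass F → ∀ x ∈ 𝓜.sets, ∃ y ∈ 𝓜.sets,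
    ∀ w ∈ 𝓜.sets, w ∈ y ↔ ∃ z ∈ x, ZFSet.pair z w ∈ F
  /-- Comprehension for all formulas, with set and class quantifiers and set and class
  parameters. -/
  comprehension : ∀ {n m : ℕ} (φ : Formula (n + 1) m) (a : Fin n → ZFSet.{u})
    (A : Fin m → ZFSet.{u}), (∀ i, a i ∈ 𝓜.sets) → (∀ i, A i ∈ 𝓜.classes) →
    ∃ Y ∈ 𝓜.classes, ∀ x ∈ 𝓜.sets, x ∈ Y ↔ 𝓜.Sat φ (Fin.cons x a) A
  /-- There is a class that well-orders the universe of sets (as a strict order). -/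
  global_choice : ∃ R ∈ 𝓜.classes,
    (∀ x ∈ 𝓜.sets, ZFSet.pair x x ∉ R) ∧
    (∀ x ∈ 𝓜.sets, ∀ y ∈ 𝓜.sets, ∀ z ∈ 𝓜.sets,
      ZFSet.pair x y ∈ R → ZFSet.pair y z ∈ R → ZFSet.pair x z ∈ R) ∧
    (∀ x ∈ 𝓜.sets, ∀ y ∈ 𝓜.sets, ZFSet.pair x y ∈ R ∨ x = y ∨ ZFSet.pair y x ∈ R) ∧
    (∀ X ∈ 𝓜.classes, (∃ x, x ∈ X) → ∃ x ∈ X, ∀ y ∈ X, x = y ∨ ZFSet.pair x y ∈ R)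

/-! ### Forcing notions and generics -/

/-- The data of a forcing notion: the conditions, and the order as a collection of pairs. -/
structure ForcingNotion where
  /-- the conditions -/
  conds : ZFSet.{u}
  /-- the graph of the order -/
  order : ZFSet.{u}

/-- `p ≤ q` in the forcing notion. -/
def ForcingNotion.LE (P : ForcingNotion.{u}) (p q : ZFSet.{u}) : Prop :=
  ZFSet.pair p q ∈ P.order

/-- `P` is an `(M, 𝒞)`-forcing: a partial order with greatest element both of whose components
belong to `𝒞`. -/
structure ForcingNotion.IsForcing (P : ForcingNotion.{u}) (𝓜 : ClassModel.{u}) : Prop where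
  conds_mem : P.conds ∈ 𝓜.classes
  order_mem : P.order ∈ 𝓜.classes
  order_subset : P.order ⊆ ZFSet.prod P.conds P.conds
  refl : ∀ p ∈ P.conds, P.LE p p
  antisymm : ∀ p q, P.LE p q → P.LE q p → p = q
  trans : ∀ p q r, P.LE p q → P.LE q r → P.LE p r
  exists_greatest : ∃ t ∈ P.conds, ∀ p ∈ P.conds, P.LE p t

/-- `D ⊆ P` is dense. -/
def ForcingNotion.IsDense (P : ForcingNotion.{u}) (D : ZFSet.{u}) : Prop :=
  D ⊆ P.conds ∧ ∀ p ∈ P.conds, ∃ d ∈ D, P.LE d p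

/-- `D` is dense below `p`. -/
def ForcingNotion.DenseBelow (P : ForcingNotion.{u}) (D : Set ZFSet.{u}) (p : ZFSet.{u}) : Prop :=
  ∀ q, P.LE q p → ∃ r, P.LE r q ∧ r ∈ D

/-- `G ⊆ P` is `P`-generic over `𝓜 = (M, 𝒞)`. -/
structure ForcingNotion.IsGeneric (P : ForcingNotion.{u}) (𝓜 : ClassModel.{u}) (G : ZFSet.{u}) :
    Prop where
  subset : G ⊆ P.conds
  compatible : ∀ p ∈ G, ∀ q ∈ G, ∃ r ∈ P.conds, P.LE r p ∧ P.LE r q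
  upward_closed : ∀ q ∈ G, ∀ p, P.LE q p → p ∈ G
  meets_dense : ∀ D ∈ 𝓜.classes, P.IsDense D → ∃ p ∈ G, p ∈ D

/-! ### Names -/

/-- The hierarchy `𝒩ˢ_α` of set-names:
`𝒩ˢ_0 = ∅`, `𝒩ˢ_{α+1}` consists of the subsets of `𝒩ˢ_α × P` that are in `M`, and unions are taken
at limits. -/
noncomputable def setNameStage (𝓜 : ClassModel.{u}) (P : ForcingNotion.{u})
    (α : Ordinal.{u}) : Set ZFSet.{u} :=
  Ordinal.limitRecOn α ∅
    (fun _ N => {σ | σ ∈ 𝓜.sets ∧ ∀ x ∈ σ, ∃ τ ∈ N, ∃ p ∈ P.conds, x = ZFSet.pair τ p})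
    (fun β _ N => {σ | ∃ (γ : Ordinal.{u}) (h : γ < β), σ ∈ N γ h})

theorem setNameStage_zero (𝓜 : ClassModel.{u}) (P : ForcingNotion.{u}) :
    setNameStage 𝓜 P 0 = ∅ := by
  simp [setNameStage]

theorem setNameStage_add_one (𝓜 : ClassModel.{u}) (P : ForcingNotion.{u}) (α : Ordinal.{u}) :
    setNameStage 𝓜 P (α + 1) = {σ | σ ∈ 𝓜.sets ∧
      ∀ x ∈ σ, ∃ τ ∈ setNameStage 𝓜 P α, ∃ p ∈ P.conds, x = ZFSet.pair τ p} := by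
  simp [setNameStage]

theorem setNameStage_limit (𝓜 : ClassModel.{u}) (P : ForcingNotion.{u}) (α : Ordinal.{u})
    (hα : Order.IsSuccLimit α) :
    setNameStage 𝓜 P α = {σ | ∃ β < α, σ ∈ setNameStage 𝓜 P β} := by
  ext σ
  simp [setNameStage, Ordinal.limitRecOn_limit _ _ _ _ hα]

/-- `𝒩ˢ`, the union of the `𝒩ˢ_α` over the ordinals `α` of `M`. -/
def setNames (𝓜 : ClassModel.{u}) (P : ForcingNotion.{u}) : Set ZFSet.{u} :=
  {σ | ∃ α : Ordinal.{u}, α.toZFSet ∈ 𝓜.sets ∧ σ ∈ setNameStage 𝓜 P α}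

/-- `𝒩`, the subclasses of `𝒩ˢ × P` that are in `𝒞`. -/
def classNames (𝓜 : ClassModel.{u}) (P : ForcingNotion.{u}) : Set ZFSet.{u} :=
  {Γ | Γ ∈ 𝓜.classes ∧ ∀ x ∈ Γ, ∃ τ ∈ setNames 𝓜 P, ∃ p ∈ P.conds, x = ZFSet.pair τ p}

/-! ### Interpretation of names and the extension -/

theorem rank_lt_of_pair_mem {τ p σ : ZFSet.{u}} (h : ZFSet.pair τ p ∈ σ) : τ.rank < σ.rank := by
  have h1 : τ ∈ ({τ} : ZFSet.{u}) := ZFSet.mem_singleton.2 rfl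
  have h2 : ({τ} : ZFSet.{u}) ∈ ZFSet.pair τ p := by simp [ZFSet.pair]
  exact ((ZFSet.rank_lt_of_mem h1).trans (ZFSet.rank_lt_of_mem h2)).trans (ZFSet.rank_lt_of_mem h)

instance small_pairs (G σ : ZFSet.{u}) :
    Small.{u} {x : ZFSet.{u} × ZFSet.{u} // x.2 ∈ G ∧ ZFSet.pair x.1 x.2 ∈ σ} :=
  small_of_injective
    (β := {y : ZFSet.{u} // y ∈ σ})
    (f := fun x => ⟨ZFSet.pair x.1.1 x.1.2, x.2.2⟩) (by
      rintro ⟨⟨a, b⟩, ha⟩ ⟨⟨c, d⟩, hc⟩ h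
      have h' := ZFSet.pair_injective (Subtype.ext_iff.1 h)
      simpa using h')

/-- The interpretation `σ^G = {τ^G : ∃ p ∈ G, ⟨τ, p⟩ ∈ σ}`, by recursion on rank. -/
noncomputable def interp (G σ : ZFSet.{u}) : ZFSet.{u} :=
  ZFSet.range fun x : {x : ZFSet.{u} × ZFSet.{u} // x.2 ∈ G ∧ ZFSet.pair x.1 x.2 ∈ σ} =>
    interp G x.1.1
termination_by σ.rank
decreasing_by exact rank_lt_of_pair_mem x.2.2

theorem mem_interp {G σ y : ZFSet.{u}} :
    y ∈ interp G σ ↔ ∃ τ p, p ∈ G ∧ ZFSet.pair τ p ∈ σ ∧ interp G τ = y := by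
  rw [interp]
  simp [and_assoc]

/-- The extension `(M, 𝒞)[G] = ({σ^G : σ ∈ 𝒩ˢ}, {Σ^G : Σ ∈ 𝒩})`. -/
noncomputable def extension (𝓜 : ClassModel.{u}) (P : ForcingNotion.{u}) (G : ZFSet.{u}) :
    ClassModel.{u} where
  sets := interp G '' setNames 𝓜 P
  classes := interp G '' classNames 𝓜 P

/-! ### The relation `⊩*` -/

/-- `p ⊩* ¬φ`, where `A q` stands for `q ⊩* φ`. -/
def ForcingNotion.starNot (P : ForcingNotion.{u}) (A : ZFSet.{u} → Prop) (p : ZFSet.{u}) : Prop :=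
  ∀ q, P.LE q p → ¬ A q

/-- `p ⊩* (φ ↔ ψ)`, where `A q` and `B q` stand for `q ⊩* φ` and `q ⊩* ψ`, and `φ ↔ ψ` abbreviates
`¬(φ ∧ ¬ψ) ∧ ¬(ψ ∧ ¬φ)`. -/
def ForcingNotion.starIff (P : ForcingNotion.{u}) (A B : ZFSet.{u} → Prop) (p : ZFSet.{u}) :
    Prop :=
  P.starNot (fun q => A q ∧ P.starNot B q) p ∧ P.starNot (fun q => B q ∧ P.starNot A q) p

/-- The two kinds of atomic formulas. -/
inductive AtomKind
  | mem
  | eq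

/-- `AtomKind.mem` comes before `AtomKind.eq` in the recursion for atomic formulas. -/
def AtomKind.index : AtomKind → ℕ
  | .mem => 0
  | .eq => 1

/-- The ordinal on which the recursion for atomic formulas proceeds. -/
noncomputable def atomRank : AtomKind → ZFSet.{u} → ZFSet.{u} → Ordinal.{u}
  | .mem, σ, γ => max (Order.succ σ.rank) γ.rank
  | .eq, σ, γ => max σ.rank γ.rank

/-- `p ⊩* σ ∈ γ` and `p ⊩* σ = γ`, by simultaneous recursion (for set-names and class-names alike);
see `starAtom_mem` and `starAtom_eq` for the two clauses. -/
def ForcingNotion.starAtom (P : ForcingNotion.{u}) (k : AtomKind) (σ γ p : ZFSet.{u}) : Prop :=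
  match k with
  | .mem => P.DenseBelow
      {q | ∃ (π r : ZFSet.{u}) (_ : ZFSet.pair π r ∈ γ), P.LE q r ∧ P.starAtom .eq π σ q} p
  | .eq => ∀ (π r : ZFSet.{u}) (_ : ZFSet.pair π r ∈ σ ∪ γ),
      P.starIff (fun q => P.starAtom .mem π σ q) (fun q => P.starAtom .mem π γ q) p
termination_by (atomRank k σ γ, k.index)
decreasing_by
  · rename_i h
    have hr := rank_lt_of_pair_mem h
    refine Prod.Lex.left _ _ ?_
    exact max_lt (hr.trans_le (le_max_right _ _))
      ((Order.lt_succ σ.rank).trans_le (le_max_left _ _))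
  · rename_i h
    have hr : π.rank < max σ.rank γ.rank := by
      rcases ZFSet.mem_union.1 h with h | h
      · exact (rank_lt_of_pair_mem h).trans_le (le_max_left _ _)
      · exact (rank_lt_of_pair_mem h).trans_le (le_max_right _ _)
    have hle : atomRank .mem π σ ≤ atomRank .eq σ γ :=
      max_le (Order.succ_le_of_lt hr) (le_max_left _ _)
    rcases hle.lt_or_eq with hlt | heq
    · exact Prod.Lex.left _ _ hlt
    · rw [heq]; exact Prod.Lex.right _ Nat.zero_lt_one
  · rename_i h
    have hr : π.rank < max σ.rank γ.rank := by
      rcases ZFSet.mem_union.1 h with h | h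
      · exact (rank_lt_of_pair_mem h).trans_le (le_max_left _ _)
      · exact (rank_lt_of_pair_mem h).trans_le (le_max_right _ _)
    have hle : atomRank .mem π γ ≤ atomRank .eq σ γ :=
      max_le (Order.succ_le_of_lt hr) (le_max_right _ _)
    rcases hle.lt_or_eq with hlt | heq
    · exact Prod.Lex.left _ _ hlt
    · rw [heq]; exact Prod.Lex.right _ Nat.zero_lt_one

theorem starAtom_mem (P : ForcingNotion.{u}) (σ γ p : ZFSet.{u}) :
    P.starAtom .mem σ γ p ↔ P.DenseBelow
      {q | ∃ π r, ZFSet.pair π r ∈ γ ∧ P.LE q r ∧ P.starAtom .eq π σ q} p := by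
  rw [ForcingNotion.starAtom]
  simp only [exists_prop]

theorem starAtom_eq (P : ForcingNotion.{u}) (σ γ p : ZFSet.{u}) :
    P.starAtom .eq σ γ p ↔ ∀ π r, ZFSet.pair π r ∈ σ ∪ γ →
      P.starIff (P.starAtom .mem π σ) (P.starAtom .mem π γ) p := by
  rw [ForcingNotion.starAtom]

/-- `p ⊩* φ(σ₀, …, σₙ₋₁, Σ₀, …, Σₘ₋₁)`. -/
def ForcingNotion.Star (P : ForcingNotion.{u}) (𝓜 : ClassModel.{u}) :
    {n m : ℕ} → Formula n m → (Fin n → ZFSet.{u}) → (Fin m → ZFSet.{u}) → ZFSet.{u} → Prop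
  | _, _, .mem s t, σ, Γ, p => P.starAtom .mem (Sum.elim σ Γ s) (Sum.elim σ Γ t) p
  | _, _, .eq s t, σ, Γ, p => P.starAtom .eq (Sum.elim σ Γ s) (Sum.elim σ Γ t) p
  | _, _, .neg φ, σ, Γ, p => P.starNot (fun q => P.Star 𝓜 φ σ Γ q) p
  | _, _, .and φ ψ, σ, Γ, p => P.Star 𝓜 φ σ Γ p ∧ P.Star 𝓜 ψ σ Γ p
  | _, _, .allSet φ, σ, Γ, p => ∀ τ ∈ setNames 𝓜 P, P.Star 𝓜 φ (Fin.cons τ σ) Γ p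
  | _, _, .allClass φ, σ, Γ, p => ∀ Δ ∈ classNames 𝓜 P, P.Star 𝓜 φ σ (Fin.cons Δ Γ) p

end MKForcing

namespace MKForcing

universe u

variable {𝓜 : ClassModel.{u}} {E : Type (u + 1)}

/-- A context: finitely many set variables and class variables, interpreted in a model of MK and
depending on a parameter from `E`. -/
structure Ctx (𝓜 : ClassModel.{u}) (E : Type (u + 1)) where
  /-- the model satisfies MK -/
  isMK : 𝓜.IsMK
  /-- the number of set variables -/
  n : ℕ
  /-- the number of class variables -/
  m : ℕ
  /-- the values of the set variables -/
  setVar : Fin n → E → ZFSet.{u}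
  /-- the values of the class variables -/
  classVar : Fin m → E → ZFSet.{u}
  setVar_mem : ∀ i e, setVar i e ∈ 𝓜.sets
  classVar_mem : ∀ i e, classVar i e ∈ 𝓜.classes

namespace Ctx

/-- The context of constant parameters. -/
def ofParams (h𝓜 : 𝓜.IsMK) {n m : ℕ} (a : Fin n → ZFSet.{u}) (A : Fin m → ZFSet.{u})
    (ha : ∀ i, a i ∈ 𝓜.sets) (hA : ∀ i, A i ∈ 𝓜.classes) : Ctx 𝓜 PUnit.{u + 2} where
  isMK := h𝓜
  n := n
  m := m
  setVar i _ := a i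
  classVar i _ := A i
  setVar_mem i _ := ha i
  classVar_mem i _ := hA i

/-- Add a set variable. -/
def pushSet (c : Ctx 𝓜 E) : Ctx 𝓜 (E × 𝓜.sets) where
  isMK := c.isMK
  n := c.n + 1
  m := c.m
  setVar := Fin.cons (fun e => e.2) (fun i e => c.setVar i e.1)
  classVar i e := c.classVar i e.1
  setVar_mem i e := by
    cases i using Fin.cases with
    | zero => exact e.2.2
    | succ i => exact c.setVar_mem i e.1
  classVar_mem i e := c.classVar_mem i e.1

/-- Add a class variable. -/
def pushClass (c : Ctx 𝓜 E) : Ctx 𝓜 (E × 𝓜.classes) where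
  isMK := c.isMK
  n := c.n
  m := c.m + 1
  setVar i e := c.setVar i e.1
  classVar := Fin.cons (fun e => e.2) (fun i e => c.classVar i e.1)
  setVar_mem i e := c.setVar_mem i e.1
  classVar_mem i e := by
    cases i using Fin.cases with
    | zero => exact e.2.2
    | succ i => exact c.classVar_mem i e.1

/-- The value of a variable of either sort. -/
def val (c : Ctx 𝓜 E) (v : Fin c.n ⊕ Fin c.m) (e : E) : ZFSet.{u} :=
  Sum.elim (fun i => c.setVar i e) (fun i => c.classVar i e) v

/-- `t` is one of the set variables of `c`. -/
def IsSetVar (c : Ctx 𝓜 E) (t : E → ZFSet.{u}) : Prop := ∃ i, t = c.setVar i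

/-- `t` is one of the variables of `c`. -/
def IsVar (c : Ctx 𝓜 E) (t : E → ZFSet.{u}) : Prop := ∃ v, t = c.val v

/-- `Q` is defined by a formula in the variables of `c`. -/
def Definable (c : Ctx 𝓜 E) (Q : E → Prop) : Prop :=
  ∃ φ : Formula c.n c.m, ∀ e,
    𝓜.Sat φ (fun i => c.setVar i e) (fun i => c.classVar i e) ↔ Q e

variable {c : Ctx 𝓜 E} {s t x y z : E → ZFSet.{u}} {Q R : E → Prop}

theorem IsSetVar.isVar (h : c.IsSetVar t) : c.IsVar t := by
  obtain ⟨i, rfl⟩ := h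
  exact ⟨.inl i, rfl⟩

theorem IsSetVar.mem (h : c.IsSetVar t) (e : E) : t e ∈ 𝓜.sets := by
  obtain ⟨i, rfl⟩ := h
  exact c.setVar_mem i e

theorem IsVar.mem_of_mem (h : c.IsVar t) {e : E} {a : ZFSet.{u}} (ha : a ∈ t e) :
    a ∈ 𝓜.sets := by
  obtain ⟨i | i, rfl⟩ := h
  · exact c.isMK.transitive _ (c.setVar_mem i e) _ ha
  · exact c.isMK.classes_subset _ (c.classVar_mem i e) _ ha

theorem IsSetVar.up (h : c.IsSetVar t) : c.pushSet.IsSetVar (fun e => t e.1) := by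
  obtain ⟨i, rfl⟩ := h
  exact ⟨i.succ, rfl⟩

theorem IsSetVar.upc (h : c.IsSetVar t) : c.pushClass.IsSetVar (fun e => t e.1) := by
  obtain ⟨i, rfl⟩ := h
  exact ⟨i, rfl⟩

theorem IsVar.up (h : c.IsVar t) : c.pushSet.IsVar (fun e => t e.1) := by
  obtain ⟨i | i, rfl⟩ := h
  · exact ⟨.inl i.succ, rfl⟩
  · exact ⟨.inr i, rfl⟩

theorem IsVar.upc (h : c.IsVar t) : c.pushClass.IsVar (fun e => t e.1) := by
  obtain ⟨i | i, rfl⟩ := h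
  · exact ⟨.inl i, rfl⟩
  · exact ⟨.inr i.succ, rfl⟩

theorem isSetVar_top : c.pushSet.IsSetVar (fun e => e.2) := ⟨(0 : Fin (c.n + 1)), rfl⟩

theorem isVar_top : c.pushClass.IsVar (fun e => e.2) := ⟨.inr (0 : Fin (c.m + 1)), rfl⟩

theorem Definable.congr (h : c.Definable Q) (hQR : ∀ e, Q e ↔ R e) : c.Definable R := by
  obtain ⟨φ, hφ⟩ := h
  exact ⟨φ, fun e => (hφ e).trans (hQR e)⟩

theorem definable_mem (hs : c.IsVar s) (ht : c.IsVar t) : c.Definable (fun e => s e ∈ t e) := by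
  obtain ⟨v, rfl⟩ := hs
  obtain ⟨w, rfl⟩ := ht
  exact ⟨.mem v w, fun e => Iff.rfl⟩

theorem definable_eq (hs : c.IsVar s) (ht : c.IsVar t) : c.Definable (fun e => s e = t e) := by
  obtain ⟨v, rfl⟩ := hs
  obtain ⟨w, rfl⟩ := ht
  exact ⟨.eq v w, fun e => Iff.rfl⟩

theorem Definable.not (h : c.Definable Q) : c.Definable (fun e => ¬ Q e) := by
  obtain ⟨φ, hφ⟩ := h
  exact ⟨.neg φ, fun e => not_congr (hφ e)⟩

theorem Definable.and (h : c.Definable Q) (h' : c.Definable R) :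
    c.Definable (fun e => Q e ∧ R e) := by
  obtain ⟨φ, hφ⟩ := h
  obtain ⟨ψ, hψ⟩ := h'
  exact ⟨.and φ ψ, fun e => and_congr (hφ e) (hψ e)⟩

theorem Definable.or (h : c.Definable Q) (h' : c.Definable R) :
    c.Definable (fun e => Q e ∨ R e) :=
  (h.not.and h'.not).not.congr fun e => by tauto

theorem Definable.imp (h : c.Definable Q) (h' : c.Definable R) :
    c.Definable (fun e => Q e → R e) :=
  (h.and h'.not).not.congr fun e => by tauto

theorem Definable.iff (h : c.Definable Q) (h' : c.Definable R) :
    c.Definable (fun e => Q e ↔ R e) :=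
  ((h.imp h').and (h'.imp h)).congr fun e => by tauto

theorem pushSet_setVar (c : Ctx 𝓜 E) (e : E) (a : 𝓜.sets) :
    (fun i => c.pushSet.setVar i (e, a)) =
      (Fin.cons (a : ZFSet.{u}) (fun i => c.setVar i e) : Fin (c.n + 1) → ZFSet.{u}) := by
  funext i
  cases i using Fin.cases <;> rfl

theorem pushClass_classVar (c : Ctx 𝓜 E) (e : E) (a : 𝓜.classes) :
    (fun i => c.pushClass.classVar i (e, a)) =
      (Fin.cons (a : ZFSet.{u}) (fun i => c.classVar i e) : Fin (c.m + 1) → ZFSet.{u}) := by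
  funext i
  cases i using Fin.cases <;> rfl

theorem Definable.allSet {Q : E → 𝓜.sets → Prop}
    (h : c.pushSet.Definable (fun e => Q e.1 e.2)) : c.Definable (fun e => ∀ a, Q e a) := by
  obtain ⟨φ, hφ⟩ := h
  refine ⟨Formula.allSet (n := c.n) (m := c.m) φ, fun e => ⟨fun H a => ?_, fun H a ha => ?_⟩⟩
  · refine (hφ (e, a)).1 ?_
    rw [pushSet_setVar]
    exact H a a.2
  · have := (hφ (e, ⟨a, ha⟩)).2 (H ⟨a, ha⟩)
    rwa [pushSet_setVar] at this

theorem Definable.allClass {Q : E → 𝓜.classes → Prop}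
    (h : c.pushClass.Definable (fun e => Q e.1 e.2)) : c.Definable (fun e => ∀ a, Q e a) := by
  obtain ⟨φ, hφ⟩ := h
  refine ⟨Formula.allClass (n := c.n) (m := c.m) φ, fun e => ⟨fun H a => ?_, fun H a ha => ?_⟩⟩
  · refine (hφ (e, a)).1 ?_
    rw [pushClass_classVar]
    exact H a a.2
  · have := (hφ (e, ⟨a, ha⟩)).2 (H ⟨a, ha⟩)
    rwa [pushClass_classVar] at this

theorem Definable.exClass {Q : E → 𝓜.classes → Prop}
    (h : c.pushClass.Definable (fun e => Q e.1 e.2)) : c.Definable (fun e => ∃ a, Q e a) :=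
  (Definable.allClass (Q := fun e a => ¬ Q e a) h.not).not.congr fun e => by simp

/-- A quantifier over all of `ZFSet` that is implicitly bounded by the model. -/
theorem Definable.all {Q : E → ZFSet.{u} → Prop}
    (h : c.pushSet.Definable (fun e => Q e.1 e.2)) (hQ : ∀ e a, ¬ Q e a → a ∈ 𝓜.sets) :
    c.Definable (fun e => ∀ a, Q e a) := by
  refine (Definable.allSet (Q := fun e a => Q e a) h).congr fun e =>
    ⟨fun H a => ?_, fun H a => H a⟩
  by_contra hn
  exact hn (H ⟨a, hQ e a hn⟩)

/-- A quantifier over all of `ZFSet` that is implicitly bounded by the model. -/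
theorem Definable.ex {Q : E → ZFSet.{u} → Prop}
    (h : c.pushSet.Definable (fun e => Q e.1 e.2)) (hQ : ∀ e a, Q e a → a ∈ 𝓜.sets) :
    c.Definable (fun e => ∃ a, Q e a) :=
  (Definable.all (Q := fun e a => ¬ Q e a) h.not fun e a hn => hQ e a (not_not.1 hn)).not.congr
    fun e => by simp

theorem Definable.const (c : Ctx 𝓜 E) (b : Prop) : c.Definable (fun _ => b) := by
  have h : c.Definable (fun _ => ∀ a, a ∈ 𝓜.sets → a = a) :=
    ((Definable.allSet (Q := fun _ a => (a : ZFSet.{u}) = a)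
      (definable_eq isSetVar_top.isVar isSetVar_top.isVar))).congr fun e => by simp
  by_cases hb : b
  · exact h.congr fun e => by simp [hb]
  · exact h.not.congr fun e => by simp [hb]

/-- Comprehension in semantic form. -/
theorem Definable.exists_class {c : Ctx 𝓜 PUnit.{u + 2}} {Q : ZFSet.{u} → Prop}
    (h : c.pushSet.Definable (fun e => Q e.2)) :
    ∃ Y ∈ 𝓜.classes, ∀ x, x ∈ Y ↔ x ∈ 𝓜.sets ∧ Q x := by
  obtain ⟨φ, hφ⟩ := h
  obtain ⟨Y, hY, H⟩ := c.isMK.comprehension φ (fun i => c.setVar i ⟨⟩)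
    (fun i => c.classVar i ⟨⟩) (fun i => c.setVar_mem i _) (fun i => c.classVar_mem i _)
  have key (x : 𝓜.sets) : (x : ZFSet.{u}) ∈ Y ↔ Q x := by
    rw [H x x.2, ← pushSet_setVar]
    exact hφ (⟨⟩, x)
  refine ⟨Y, hY, fun x => ⟨fun hx => ?_, fun hx => (key ⟨x, hx.1⟩).2 hx.2⟩⟩
  have hxM := c.isMK.classes_subset _ hY _ hx
  exact ⟨hxM, (key ⟨x, hxM⟩).1 hx⟩

end Ctx

namespace ClassModel.IsMK

theorem unordered_pair_mem (h𝓜 : 𝓜.IsMK) {a b : ZFSet.{u}} (ha : a ∈ 𝓜.sets)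
    (hb : b ∈ 𝓜.sets) : ({a, b} : ZFSet.{u}) ∈ 𝓜.sets := by
  obtain ⟨z, hz, H⟩ := h𝓜.pairing a ha b hb
  have : z = {a, b} := by
    ext w
    rw [ZFSet.mem_pair]
    constructor
    · exact fun hw => (H w (h𝓜.transitive z hz w hw)).1 hw
    · rintro (rfl | rfl)
      · exact (H _ ha).2 (.inl rfl)
      · exact (H _ hb).2 (.inr rfl)
  exact this ▸ hz

theorem singleton_mem (h𝓜 : 𝓜.IsMK) {a : ZFSet.{u}} (ha : a ∈ 𝓜.sets) :
    ({a} : ZFSet.{u}) ∈ 𝓜.sets := by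
  simpa using h𝓜.unordered_pair_mem ha ha

theorem sUnion_mem (h𝓜 : 𝓜.IsMK) {a : ZFSet.{u}} (ha : a ∈ 𝓜.sets) :
    ZFSet.sUnion a ∈ 𝓜.sets := by
  obtain ⟨y, hy, H⟩ := h𝓜.union a ha
  have : y = ZFSet.sUnion a := by
    ext w
    rw [ZFSet.mem_sUnion]
    constructor
    · exact fun hw => (H w (h𝓜.transitive y hy w hw)).1 hw
    · rintro ⟨z, hz, hw⟩
      exact (H w (h𝓜.transitive z (h𝓜.transitive a ha z hz) w hw)).2 ⟨z, hz, hw⟩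
  exact this ▸ hy

theorem insert_mem (h𝓜 : 𝓜.IsMK) {a b : ZFSet.{u}} (ha : a ∈ 𝓜.sets) (hb : b ∈ 𝓜.sets) :
    insert a b ∈ 𝓜.sets := by
  rw [ZFSet.insert_eq, ← ZFSet.sUnion_pair]
  exact h𝓜.sUnion_mem (h𝓜.unordered_pair_mem (h𝓜.singleton_mem ha) hb)

theorem pair_mem (h𝓜 : 𝓜.IsMK) {a b : ZFSet.{u}} :
    ZFSet.pair a b ∈ 𝓜.sets ↔ a ∈ 𝓜.sets ∧ b ∈ 𝓜.sets := by
  constructor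
  · intro h
    have h1 : ({a, b} : ZFSet.{u}) ∈ 𝓜.sets := h𝓜.transitive _ h _ (by simp [ZFSet.pair])
    exact ⟨h𝓜.transitive _ h1 _ (by simp), h𝓜.transitive _ h1 _ (by simp)⟩
  · rintro ⟨ha, hb⟩
    exact h𝓜.unordered_pair_mem (h𝓜.singleton_mem ha) (h𝓜.unordered_pair_mem ha hb)

end ClassModel.IsMK

namespace Ctx

variable {c : Ctx 𝓜 E} {s t x y z : E → ZFSet.{u}} {Q R : E → Prop}

theorem IsVar.left_mem (h : c.IsVar t) {e : E} {a b : ZFSet.{u}} (hab : ZFSet.pair a b ∈ t e) :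
    a ∈ 𝓜.sets :=
  (c.isMK.pair_mem.1 (h.mem_of_mem hab)).1

theorem IsVar.right_mem (h : c.IsVar t) {e : E} {a b : ZFSet.{u}} (hab : ZFSet.pair a b ∈ t e) :
    b ∈ 𝓜.sets :=
  (c.isMK.pair_mem.1 (h.mem_of_mem hab)).2

theorem definable_eq_unordered_pair (hx : c.IsSetVar x) (hs : c.IsSetVar s) (ht : c.IsSetVar t) :
    c.Definable (fun e => x e = {s e, t e}) := by
  refine Definable.congr (Q := fun e => ∀ w, w ∈ x e ↔ w = s e ∨ w = t e) (Definable.all ?_ ?_)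
    fun e => by simp [ZFSet.ext_iff]
  · exact (definable_mem isSetVar_top.isVar hx.isVar.up).iff
      ((definable_eq isSetVar_top.isVar hs.isVar.up).or
        (definable_eq isSetVar_top.isVar ht.isVar.up))
  · intro e a h
    by_contra ha
    refine h ⟨fun h => (ha (hx.isVar.mem_of_mem h)).elim, ?_⟩
    rintro (rfl | rfl)
    exacts [(ha (hs.mem e)).elim, (ha (ht.mem e)).elim]

theorem definable_eq_pair (hx : c.IsSetVar x) (hs : c.IsSetVar s) (ht : c.IsSetVar t) :
    c.Definable (fun e => x e = ZFSet.pair (s e) (t e)) := by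
  refine Definable.congr (Q := fun e => ∃ a b, (a = {s e, s e} ∧ b = {s e, t e}) ∧ x e = {a, b})
    (Definable.ex (Definable.ex ?_ ?_) ?_) fun e => by simp [ZFSet.pair]
  · exact ((definable_eq_unordered_pair isSetVar_top.up hs.up.up hs.up.up).and
      (definable_eq_unordered_pair isSetVar_top hs.up.up ht.up.up)).and
      (definable_eq_unordered_pair hx.up.up isSetVar_top.up isSetVar_top)
  · rintro e a ⟨⟨-, rfl⟩, -⟩
    exact c.isMK.unordered_pair_mem (hs.mem _) (ht.mem _)
  · rintro e a ⟨b, ⟨rfl, -⟩, -⟩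
    exact c.isMK.unordered_pair_mem (hs.mem _) (hs.mem _)

theorem definable_pair_mem (hs : c.IsSetVar s) (ht : c.IsSetVar t) (hx : c.IsVar x) :
    c.Definable (fun e => ZFSet.pair (s e) (t e) ∈ x e) := by
  refine Definable.congr (Q := fun e => ∃ a, a = ZFSet.pair (s e) (t e) ∧ a ∈ x e)
    (Definable.ex ?_ fun e a h => hx.mem_of_mem h.2) fun e => by simp
  exact (definable_eq_pair isSetVar_top hs.up ht.up).and (definable_mem isSetVar_top.isVar hx.up)

theorem definable_pair_pair_mem (hs : c.IsSetVar s) (ht : c.IsSetVar t) (hy : c.IsSetVar y)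
    (hx : c.IsVar x) : c.Definable (fun e => ZFSet.pair (s e) (ZFSet.pair (t e) (y e)) ∈ x e) := by
  refine Definable.congr (Q := fun e => ∃ a, a = ZFSet.pair (t e) (y e) ∧ ZFSet.pair (s e) a ∈ x e)
    (Definable.ex ?_ fun e a h => hx.right_mem h.2) fun e => by simp
  exact (definable_eq_pair isSetVar_top ht.up hy.up).and
    (definable_pair_mem hs.up isSetVar_top hx.up)

end Ctx

variable {P : ForcingNotion.{u}}

namespace Ctx

variable {c : Ctx 𝓜 E} {s t x y z : E → ZFSet.{u}}

theorem Definable.ball {Q : E → ZFSet.{u} → Prop} (hy : c.IsVar y)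
    (h : c.pushSet.Definable (fun e => Q e.1 e.2)) :
    c.Definable (fun e => ∀ a ∈ y e, Q e a) :=
  Definable.all ((definable_mem isSetVar_top.isVar hy.up).imp h) fun _ _ hn =>
    hy.mem_of_mem (Classical.not_imp.1 hn).1

theorem Definable.bex {Q : E → ZFSet.{u} → Prop} (hy : c.IsVar y)
    (h : c.pushSet.Definable (fun e => Q e.1 e.2)) :
    c.Definable (fun e => ∃ a ∈ y e, Q e a) :=
  Definable.ex ((definable_mem isSetVar_top.isVar hy.up).and h) fun _ _ hn => hy.mem_of_mem hn.1

theorem Definable.all_le {Q : E → ZFSet.{u} → Prop} (hP : c.IsVar (fun _ => P.order))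
    (hy : c.IsSetVar y) (h : c.pushSet.Definable (fun e => Q e.1 e.2)) :
    c.Definable (fun e => ∀ q, P.LE q (y e) → Q e q) :=
  Definable.all ((definable_pair_mem isSetVar_top hy.up hP.up).imp h) fun _ _ hn =>
    hP.left_mem (e := ‹_›) (Classical.not_imp.1 hn).1

theorem Definable.ex_le {Q : E → ZFSet.{u} → Prop} (hP : c.IsVar (fun _ => P.order))
    (hy : c.IsSetVar y) (h : c.pushSet.Definable (fun e => Q e.1 e.2)) :
    c.Definable (fun e => ∃ q, P.LE q (y e) ∧ Q e q) :=
  Definable.ex ((definable_pair_mem isSetVar_top hy.up hP.up).and h) fun _ _ hn =>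
    hP.left_mem (e := ‹_›) hn.1

theorem Definable.starNot {Q : E → ZFSet.{u} → Prop} (hP : c.IsVar (fun _ => P.order))
    (hy : c.IsSetVar y) (h : c.pushSet.Definable (fun e => Q e.1 e.2)) :
    c.Definable (fun e => P.starNot (Q e) (y e)) :=
  Definable.all_le hP hy h.not

theorem Definable.denseBelow {D : E → Set ZFSet.{u}} (hP : c.IsVar (fun _ => P.order))
    (hy : c.IsSetVar y) (h : c.pushSet.pushSet.Definable (fun e => (e.2 : ZFSet.{u}) ∈ D e.1.1)) :
    c.Definable (fun e => P.DenseBelow (D e) (y e)) :=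
  Definable.all_le hP hy (Definable.ex_le hP.up isSetVar_top h)

end Ctx

open Ctx

/-! ### Fixed points of definable monotone operators -/

/-- `Φ X Y x` is defined, for class variables `X`, `Y` and a set variable `x`, by a formula with
the parameter `A`. -/
def OperatorDefinable (𝓜 : ClassModel.{u}) (A : ZFSet.{u})
    (Φ : ZFSet.{u} → ZFSet.{u} → ZFSet.{u} → Prop) : Prop :=
  ∀ {E : Type (u + 1)} (c : Ctx 𝓜 E) {X Y x : E → ZFSet.{u}}, c.IsVar (fun _ => A) →
    c.IsVar X → c.IsVar Y → c.IsSetVar x → c.Definable (fun e => Φ (X e) (Y e) (x e))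

theorem ClassModel.IsMK.exists_fixed_pair (h𝓜 : 𝓜.IsMK) {A : ZFSet.{u}} (hA : A ∈ 𝓜.classes)
    {Φ Ψ : ZFSet.{u} → ZFSet.{u} → ZFSet.{u} → Prop}
    (hΦ : OperatorDefinable 𝓜 A Φ) (hΨ : OperatorDefinable 𝓜 A Ψ)
    (mΦ : ∀ X Y X' Y' : ZFSet.{u}, X ⊆ X' → Y ⊆ Y' → ∀ x, Φ X Y x → Φ X' Y' x)
    (mΨ : ∀ X Y X' Y' : ZFSet.{u}, X ⊆ X' → Y ⊆ Y' → ∀ x, Ψ X Y x → Ψ X' Y' x) :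
    ∃ U ∈ 𝓜.classes, ∃ V ∈ 𝓜.classes, ∀ x ∈ 𝓜.sets,
      (x ∈ U ↔ Φ U V x) ∧ (x ∈ V ↔ Ψ U V x) := by
  have exists_union : ∀ b : Prop, ∃ U ∈ 𝓜.classes, ∀ x, x ∈ U ↔ x ∈ 𝓜.sets ∧
      ∃ X Y : 𝓜.classes, ((∀ a ∈ (X : ZFSet.{u}), Φ X Y a) ∧ ∀ a ∈ (Y : ZFSet.{u}), Ψ X Y a) ∧
        ((b ∧ x ∈ (X : ZFSet.{u})) ∨ (¬ b ∧ x ∈ (Y : ZFSet.{u}))) := by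
    intro b
    let c := Ctx.ofParams h𝓜 ![] ![A] (by simp) (by simpa using hA)
    have hc : c.IsVar (fun _ => A) := ⟨.inr (0 : Fin 1), rfl⟩
    refine Definable.exists_class (c := c) (Definable.exClass (Definable.exClass ?_))
    have hX := isVar_top (c := c.pushSet).upc
    have hY := isVar_top (c := c.pushSet.pushClass)
    refine Definable.and (Definable.and (Definable.ball hX ?_) (Definable.ball hY ?_)) ?_
    · exact hΦ _ hc.up.upc.upc.up hX.up hY.up isSetVar_top
    · exact hΨ _ hc.up.upc.upc.up hX.up hY.up isSetVar_top
    · have hx := (isSetVar_top (c := c)).upc.upc.isVar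
      exact ((Definable.const _ _).and (definable_mem hx hX)).or
        ((Definable.const _ _).and (definable_mem hx hY))
  obtain ⟨U, hU, memU⟩ := exists_union True
  obtain ⟨V, hV, memV⟩ := exists_union False
  simp only [true_and, not_true_eq_false, false_and, or_false, not_false_eq_true, false_or]
    at memU memV
  have le : ∀ X ∈ 𝓜.classes, ∀ Y ∈ 𝓜.classes, (∀ a ∈ X, Φ X Y a) → (∀ a ∈ Y, Ψ X Y a) →
      X ⊆ U ∧ Y ⊆ V := fun X hX Y hY h h' =>
    ⟨fun x hx => (memU x).2 ⟨h𝓜.classes_subset X hX x hx, ⟨X, hX⟩, ⟨Y, hY⟩, ⟨h, h'⟩, hx⟩,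
      fun x hx => (memV x).2 ⟨h𝓜.classes_subset Y hY x hx, ⟨X, hX⟩, ⟨Y, hY⟩, ⟨h, h'⟩, hx⟩⟩
  have postU : ∀ x ∈ U, Φ U V x := by
    intro x hx
    obtain ⟨-, X, Y, ⟨h, h'⟩, hxX⟩ := (memU x).1 hx
    have := le X X.2 Y Y.2 h h'
    exact mΦ _ _ _ _ this.1 this.2 x (h x hxX)
  have postV : ∀ x ∈ V, Ψ U V x := by
    intro x hx
    obtain ⟨-, X, Y, ⟨h, h'⟩, hxY⟩ := (memV x).1 hx
    have := le X X.2 Y Y.2 h h'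
    exact mΨ _ _ _ _ this.1 this.2 x (h' x hxY)
  let c := Ctx.ofParams h𝓜 ![] ![A, U, V] (by simp) (by simp [Fin.forall_fin_succ, hA, hU, hV])
  have hc : c.IsVar (fun _ => A) := ⟨.inr (0 : Fin 3), rfl⟩
  have hcU : c.IsVar (fun _ => U) := ⟨.inr (1 : Fin 3), rfl⟩
  have hcV : c.IsVar (fun _ => V) := ⟨.inr (2 : Fin 3), rfl⟩
  obtain ⟨U', hU', memU'⟩ := Definable.exists_class (c := c) (Q := fun x => Φ U V x)
    (hΦ _ hc.up hcU.up hcV.up isSetVar_top)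
  obtain ⟨V', hV', memV'⟩ := Definable.exists_class (c := c) (Q := fun x => Ψ U V x)
    (hΨ _ hc.up hcU.up hcV.up isSetVar_top)
  have sU : U ⊆ U' := fun x hx => (memU' x).2 ⟨h𝓜.classes_subset U hU x hx, postU x hx⟩
  have sV : V ⊆ V' := fun x hx => (memV' x).2 ⟨h𝓜.classes_subset V hV x hx, postV x hx⟩
  have := le U' hU' V' hV'
    (fun x hx => mΦ _ _ _ _ sU sV x ((memU' x).1 hx).2)
    (fun x hx => mΨ _ _ _ _ sU sV x ((memV' x).1 hx).2)
  exact ⟨U, hU, V, hV, fun x hx =>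
    ⟨⟨postU x, fun h => this.1 ((memU' x).2 ⟨hx, h⟩)⟩,
      ⟨postV x, fun h => this.2 ((memV' x).2 ⟨hx, h⟩)⟩⟩⟩

theorem ClassModel.IsMK.exists_fixed (h𝓜 : 𝓜.IsMK) {A : ZFSet.{u}} (hA : A ∈ 𝓜.classes)
    {Φ : ZFSet.{u} → ZFSet.{u} → Prop} (hΦ : OperatorDefinable 𝓜 A (fun X _ x => Φ X x))
    (mΦ : ∀ X X' : ZFSet.{u}, X ⊆ X' → ∀ x, Φ X x → Φ X' x) :
    ∃ U ∈ 𝓜.classes, ∀ x ∈ 𝓜.sets, (x ∈ U ↔ Φ U x) := by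
  obtain ⟨U, hU, _, _, h⟩ := h𝓜.exists_fixed_pair hA hΦ hΦ
    (fun X _ X' _ h _ => mΦ X X' h) (fun X _ X' _ h _ => mΦ X X' h)
  exact ⟨U, hU, fun x hx => (h x hx).1⟩

/-! ### Ranks -/

theorem ClassModel.IsMK.exists_rank_le (h𝓜 : 𝓜.IsMK) : ∃ U ∈ 𝓜.classes,
    ∀ x ∈ 𝓜.sets, ∀ y ∈ 𝓜.sets, (ZFSet.pair x y ∈ U ↔ x.rank ≤ y.rank) := by
  obtain ⟨A, hA, -⟩ := h𝓜.global_choice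
  obtain ⟨U, hU, H⟩ := h𝓜.exists_fixed hA
    (Φ := fun X w => ∃ x y, w = ZFSet.pair x y ∧ ∀ z ∈ x, ∃ v ∈ y, ZFSet.pair z v ∈ X)
    (by
      intro E c X Y w _ hX _ hw
      refine Definable.ex (Definable.ex ((definable_eq_pair hw.up.up isSetVar_top.up
        isSetVar_top).and ?_) ?_) ?_
      · exact Definable.ball isSetVar_top.up.isVar (Definable.bex isSetVar_top.up.isVar
          (definable_pair_mem isSetVar_top.up isSetVar_top hX.up.up.up.up))
      · rintro e y ⟨h, -⟩
        exact (h𝓜.pair_mem.1 (h ▸ hw.mem e.1)).2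
      · rintro e x ⟨y, h, -⟩
        exact (h𝓜.pair_mem.1 (h ▸ hw.mem e)).1)
    (by
      rintro X X' h w ⟨x, y, rfl, H⟩
      refine ⟨x, y, rfl, fun z hz => ?_⟩
      obtain ⟨v, hv, hzv⟩ := H z hz
      exact ⟨v, hv, h hzv⟩)
  refine ⟨U, hU, fun x => ?_⟩
  induction x using ZFSet.inductionOn with
  | h x ih =>
    intro hx y hy
    rw [H _ (h𝓜.pair_mem.2 ⟨hx, hy⟩), ZFSet.rank_le_iff]
    simp only [ZFSet.lt_rank_iff]
    constructor
    · rintro ⟨x', y', h, H⟩ z hz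
      obtain ⟨rfl, rfl⟩ := ZFSet.pair_injective h
      obtain ⟨v, hv, hzv⟩ := H z hz
      exact ⟨v, hv, (ih z hz (h𝓜.transitive _ hx _ hz) v (h𝓜.transitive _ hy _ hv)).1 hzv⟩
    · refine fun H => ⟨x, y, rfl, fun z hz => ?_⟩
      obtain ⟨v, hv, hzv⟩ := H hz
      exact ⟨v, hv, (ih z hz (h𝓜.transitive _ hx _ hz) v (h𝓜.transitive _ hy _ hv)).2 hzv⟩

namespace Ctx

variable {c : Ctx 𝓜 E} {s t x y z : E → ZFSet.{u}}

theorem definable_isTransitive (ht : c.IsSetVar t) :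
    c.Definable (fun e => (t e).IsTransitive) :=
  Definable.ball ht.isVar (Definable.ball isSetVar_top.isVar
    (definable_mem isSetVar_top.isVar ht.up.up.isVar))

theorem definable_isOrdinal (ht : c.IsSetVar t) : c.Definable (fun e => (t e).IsOrdinal) :=
  ((definable_isTransitive ht).and (Definable.ball ht.isVar
    (definable_isTransitive isSetVar_top))).congr fun _ =>
      ZFSet.isOrdinal_iff_forall_mem_isTransitive.symm

end Ctx

theorem ClassModel.IsMK.rank_mem (h𝓜 : 𝓜.IsMK) (x : ZFSet.{u}) (hx : x ∈ 𝓜.sets) :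
    (x.rank + 1).toZFSet ∈ 𝓜.sets := by
  obtain ⟨U, hU, memU⟩ := h𝓜.exists_rank_le
  let c := Ctx.ofParams h𝓜 ![] ![U] (by simp) (by simpa using hU)
  have hc : c.IsVar (fun _ => U) := ⟨.inr (0 : Fin 1), rfl⟩
  obtain ⟨F, hF, memF⟩ := Definable.exists_class (c := c)
    (Q := fun w => ∃ y s, w = ZFSet.pair y s ∧
      ∀ v : 𝓜.sets, (v : ZFSet.{u}) ∈ s ↔ (v : ZFSet.{u}).IsOrdinal ∧ ZFSet.pair v y ∈ U)
    (by
      refine Definable.ex (Definable.ex ((definable_eq_pair isSetVar_top.up.up isSetVar_top.up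
        isSetVar_top).and (Definable.allSet ?_)) ?_) ?_
      · exact (definable_mem isSetVar_top.isVar isSetVar_top.up.isVar).iff
          ((definable_isOrdinal isSetVar_top).and (definable_pair_mem isSetVar_top
            isSetVar_top.up.up hc.up.up.up.up))
      · rintro e s ⟨h, -⟩
        exact (h𝓜.pair_mem.1 (h ▸ e.1.2.2)).2
      · rintro e y ⟨s, h, -⟩
        exact (h𝓜.pair_mem.1 (h ▸ e.2.2)).1)
  have pairF : ∀ y s, ZFSet.pair y s ∈ F ↔ (y ∈ 𝓜.sets ∧ s ∈ 𝓜.sets) ∧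
      ∀ v ∈ 𝓜.sets, v ∈ s ↔ v.IsOrdinal ∧ ZFSet.pair v y ∈ U := by
    intro y s
    rw [memF, h𝓜.pair_mem]
    refine and_congr_right fun _ => ⟨?_, fun h => ⟨y, s, rfl, fun v => h v v.2⟩⟩
    rintro ⟨y', s', h, H⟩
    obtain ⟨rfl, rfl⟩ := ZFSet.pair_injective h
    exact fun v hv => H ⟨v, hv⟩
  have mem_succ_rank : ∀ y ∈ 𝓜.sets, ∀ v ∈ 𝓜.sets,
      v ∈ (y.rank + 1).toZFSet ↔ v.IsOrdinal ∧ ZFSet.pair v y ∈ U := by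
    intro y hy v hv
    rw [memU v hv y hy, Ordinal.mem_toZFSet_iff]
    constructor
    · rintro ⟨a, ha, rfl⟩
      exact ⟨ZFSet.isOrdinal_toZFSet a, by simpa [Order.lt_add_one_iff] using ha⟩
    · exact fun h => ⟨v.rank, Order.lt_add_one_iff.2 h.2, h.1.toZFSet_rank_eq⟩
  have unique : ∀ y s, ZFSet.pair y s ∈ F → (y.rank + 1).toZFSet ∈ 𝓜.sets →
      s = (y.rank + 1).toZFSet := by
    intro y s h hr
    obtain ⟨⟨hy, hs⟩, H⟩ := (pairF y s).1 h
    ext v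
    exact ⟨fun hv => (mem_succ_rank y hy v (h𝓜.transitive _ hs _ hv)).2
        ((H v (h𝓜.transitive _ hs _ hv)).1 hv),
      fun hv => (H v (h𝓜.transitive _ hr _ hv)).2
        ((mem_succ_rank y hy v (h𝓜.transitive _ hr _ hv)).1 hv)⟩
  have F_fun : IsFunctionClass F := by
    refine ⟨fun z hz => ?_, fun y s s' h h' => ?_⟩
    · obtain ⟨-, y, s, h, -⟩ := (memF z).1 hz
      exact ⟨y, s, h⟩
    · obtain ⟨⟨-, hs⟩, H⟩ := (pairF y s).1 h
      obtain ⟨⟨-, hs'⟩, H'⟩ := (pairF y s').1 h'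
      refine h𝓜.set_extensionality s hs s' hs' fun v hv => ?_
      rw [H v hv, H' v hv]
  induction x using ZFSet.inductionOn with
  | h x ih =>
    have hmem : ∀ y ∈ x, y ∈ 𝓜.sets := h𝓜.transitive x hx
    obtain ⟨S, hS, memS⟩ := h𝓜.replacement F hF F_fun x hx
    have key : ZFSet.sUnion S = x.rank.toZFSet := by
      ext v
      rw [ZFSet.mem_sUnion, Ordinal.mem_toZFSet_iff]
      constructor
      · rintro ⟨s, hs, hv⟩
        obtain ⟨y, hy, hys⟩ := (memS s (h𝓜.transitive _ hS _ hs)).1 hs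
        rw [unique y s hys (ih y hy (hmem y hy)), Ordinal.mem_toZFSet_iff] at hv
        obtain ⟨a, ha, rfl⟩ := hv
        exact ⟨a, (Order.lt_add_one_iff.1 ha).trans_lt (ZFSet.rank_lt_of_mem hy), rfl⟩
      · rintro ⟨a, ha, rfl⟩
        obtain ⟨y, hy, hay⟩ := ZFSet.lt_rank_iff.1 ha
        have hr := ih y hy (hmem y hy)
        refine ⟨(y.rank + 1).toZFSet, (memS _ hr).2 ⟨y, hy, ?_⟩, ?_⟩
        · exact (pairF _ _).2 ⟨⟨hmem y hy, hr⟩, mem_succ_rank y (hmem y hy)⟩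
        · exact Ordinal.toZFSet_mem_toZFSet_iff.2 (Order.lt_add_one_iff.2 hay)
    have hr : x.rank.toZFSet ∈ 𝓜.sets := key ▸ h𝓜.sUnion_mem hS
    rw [Ordinal.toZFSet_add_one]
    exact h𝓜.insert_mem hr hr

/-! ### The class of set-names -/

theorem setNameStage_mono (𝓜 : ClassModel.{u}) (P : ForcingNotion.{u}) {α β : Ordinal.{u}}
    (h : α ≤ β) : setNameStage 𝓜 P α ⊆ setNameStage 𝓜 P β := by
  induction β using WellFoundedLT.induction generalizing α with
  | ind β ih =>
    have succ_step : ∀ γ < β, ∀ δ ≤ γ,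
        setNameStage 𝓜 P (δ + 1) ⊆ setNameStage 𝓜 P (γ + 1) := by
      intro γ hγ δ hδ σ hσ
      rw [setNameStage_add_one] at hσ ⊢
      refine ⟨hσ.1, fun x hx => ?_⟩
      obtain ⟨τ, hτ, p, hp, rfl⟩ := hσ.2 x hx
      exact ⟨τ, ih γ hγ hδ hτ, p, hp, rfl⟩
    rcases h.eq_or_lt with rfl | h
    · exact subset_rfl
    have mem_succ : ∀ δ ≤ α, ∀ σ ∈ setNameStage 𝓜 P δ,
        ∃ γ < δ, σ ∈ setNameStage 𝓜 P (γ + 1) := by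
      intro δ
      induction δ using WellFoundedLT.induction with
      | ind δ ihδ =>
        intro hδ σ hσ
        rcases Ordinal.zero_or_succ_or_isSuccLimit δ with rfl | ⟨γ, rfl⟩ | hl
        · simp [setNameStage_zero] at hσ
        · exact ⟨γ, Order.lt_succ γ, hσ⟩
        · rw [setNameStage_limit _ _ _ hl] at hσ
          obtain ⟨γ, hγ, hσ⟩ := hσ
          obtain ⟨ε, hε, hσ⟩ := ihδ γ hγ (hγ.le.trans hδ) σ hσ
          exact ⟨ε, hε.trans hγ, hσ⟩
    rcases Ordinal.zero_or_succ_or_isSuccLimit β with rfl | ⟨γ, rfl⟩ | hl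
    · exact absurd h (not_lt_zero)
    · intro σ hσ
      obtain ⟨δ, hδ, hσ⟩ := mem_succ α le_rfl σ hσ
      exact succ_step γ (Order.lt_succ γ) δ (hδ.le.trans (Order.lt_succ_iff.1 h)) hσ
    · intro σ hσ
      rw [setNameStage_limit _ _ _ hl]
      exact ⟨α, h, hσ⟩

theorem setNames_subset_sets {σ : ZFSet.{u}} (hσ : σ ∈ setNames 𝓜 P) :
    σ ∈ 𝓜.sets := by
  obtain ⟨α, -, hσ⟩ := hσ
  induction α using WellFoundedLT.induction with
  | ind α ih =>
    rcases Ordinal.zero_or_succ_or_isSuccLimit α with rfl | ⟨γ, rfl⟩ | hl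
    · simp [setNameStage_zero] at hσ
    · rw [Order.succ_eq_add_one, setNameStage_add_one] at hσ
      exact hσ.1
    · rw [setNameStage_limit _ _ _ hl] at hσ
      obtain ⟨γ, hγ, hσ⟩ := hσ
      exact ih γ hγ hσ

theorem ForcingNotion.IsForcing.mem_conds_iff (hP : P.IsForcing 𝓜) {p : ZFSet.{u}} :
    p ∈ P.conds ↔ P.LE p p :=
  ⟨hP.refl p, fun h => (ZFSet.pair_mem_prod.1 (hP.order_subset h)).1⟩

theorem ForcingNotion.IsForcing.left_mem (hP : P.IsForcing 𝓜) {p q : ZFSet.{u}} (h : P.LE p q) :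
    p ∈ P.conds :=
  (ZFSet.pair_mem_prod.1 (hP.order_subset h)).1

theorem ForcingNotion.IsForcing.right_mem (hP : P.IsForcing 𝓜) {p q : ZFSet.{u}}
    (h : P.LE p q) : q ∈ P.conds :=
  (ZFSet.pair_mem_prod.1 (hP.order_subset h)).2

theorem exists_class_setNames (h𝓜 : 𝓜.IsMK) (hP : P.IsForcing 𝓜) :
    ∃ N ∈ 𝓜.classes, ∀ σ, σ ∈ N ↔ σ ∈ setNames 𝓜 P := by
  obtain ⟨N, hN, H⟩ := h𝓜.exists_fixed hP.order_mem
    (Φ := fun X σ => ∀ x ∈ σ, ∃ τ ∈ X, ∃ p, P.LE p p ∧ x = ZFSet.pair τ p)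
    (by
      intro E c X Y σ hA hX _ hσ
      refine Definable.ball hσ.isVar (Definable.bex hX.up (Definable.ex ((definable_pair_mem
        isSetVar_top isSetVar_top hA.up.up.up).and (definable_eq_pair isSetVar_top.up.up
          isSetVar_top.up isSetVar_top)) ?_))
      rintro e p ⟨h, -⟩
      exact h𝓜.classes_subset _ hP.conds_mem _ (hP.left_mem h))
    (by
      intro X X' h σ H x hx
      obtain ⟨τ, hτ, p, hp, rfl⟩ := H x hx
      exact ⟨τ, h hτ, p, hp, rfl⟩)
  refine ⟨N, hN, fun σ => ⟨fun hσ => ?_, fun hσ => ?_⟩⟩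
  · have hσM := h𝓜.classes_subset N hN σ hσ
    refine ⟨σ.rank + 1, h𝓜.rank_mem σ hσM, ?_⟩
    clear hσM
    obtain ⟨α, hα⟩ : ∃ α, σ.rank = α := ⟨_, rfl⟩
    induction α using WellFoundedLT.induction generalizing σ with
    | ind α ih =>
      subst hα
      rw [setNameStage_add_one]
      have hσM := h𝓜.classes_subset N hN σ hσ
      refine ⟨hσM, fun x hx => ?_⟩
      obtain ⟨τ, hτ, p, hp, rfl⟩ := (H σ hσM).1 hσ x hx
      have hlt := rank_lt_of_pair_mem hx
      exact ⟨τ, setNameStage_mono 𝓜 P (Order.add_one_le_of_lt hlt) (ih _ hlt τ hτ rfl), p,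
        hP.left_mem hp, rfl⟩
  · obtain ⟨α, -, hσα⟩ := id hσ
    have hσM := setNames_subset_sets hσ
    clear hσ
    induction α using WellFoundedLT.induction generalizing σ with
    | ind α ih =>
      rcases Ordinal.zero_or_succ_or_isSuccLimit α with rfl | ⟨γ, rfl⟩ | hl
      · simp [setNameStage_zero] at hσα
      · rw [Order.succ_eq_add_one, setNameStage_add_one] at hσα
        refine (H σ hσM).2 fun x hx => ?_
        obtain ⟨τ, hτ, p, hp, rfl⟩ := hσα.2 x hx
        exact ⟨τ, ih γ (Order.lt_succ γ) τ hτ (h𝓜.pair_mem.1 (h𝓜.transitive _ hσM _ hx)).1, p,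
          hP.refl p hp, rfl⟩
      · rw [setNameStage_limit _ _ _ hl] at hσα
        obtain ⟨γ, hγ, hσγ⟩ := hσα
        exact ih γ hγ σ hσγ hσM

/-! ### The recursion for atomic formulas -/

/-- The clause for `p ⊩* π ∈ γ`, with `T` in place of the relation for `=`. -/
def ForcingNotion.memClause (P : ForcingNotion.{u})
    (T : ZFSet.{u} → ZFSet.{u} → ZFSet.{u} → Prop) (π γ p : ZFSet.{u}) : Prop :=
  P.DenseBelow {q | ∃ π' r, ZFSet.pair π' r ∈ γ ∧ P.LE q r ∧ T π' π q} p

/-- Half of the clause for `p ⊩* σ = γ`: every `q ≤ p` forcing `π ∈ σ` does not force `¬ π ∈ γ`.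
The relation for `=` is replaced by `T` where it occurs positively and by `T'` where it occurs
negatively. -/
def ForcingNotion.impClause (P : ForcingNotion.{u})
    (T T' : ZFSet.{u} → ZFSet.{u} → ZFSet.{u} → Prop) (π σ γ p : ZFSet.{u}) : Prop :=
  P.starNot (fun q => P.memClause T' π σ q ∧ P.starNot (P.memClause T π γ) q) p

/-- The clause for `p ⊩* σ = γ`, with the relation for `=` replaced by `T` where it occurs
positively and by `T'` where it occurs negatively. -/
def ForcingNotion.eqClause (P : ForcingNotion.{u})
    (T T' : ZFSet.{u} → ZFSet.{u} → ZFSet.{u} → Prop) (σ γ p : ZFSet.{u}) : Prop :=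
  ∀ π r, (ZFSet.pair π r ∈ σ ∨ ZFSet.pair π r ∈ γ) →
    P.impClause T T' π σ γ p ∧ P.impClause T T' π γ σ p

theorem starAtom_mem_iff_memClause {σ γ p : ZFSet.{u}} :
    P.starAtom .mem σ γ p ↔ P.memClause (P.starAtom .eq) σ γ p :=
  starAtom_mem P σ γ p

theorem starAtom_eq_iff_eqClause {σ γ p : ZFSet.{u}} :
    P.starAtom .eq σ γ p ↔ P.eqClause (P.starAtom .eq) (P.starAtom .eq) σ γ p := by
  have h : P.starAtom .mem = P.memClause (P.starAtom .eq) := by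
    funext σ γ p
    exact propext starAtom_mem_iff_memClause
  rw [starAtom_eq, h]
  simp only [ZFSet.mem_union]
  rfl

section Mono

variable {S S' T T' : ZFSet.{u} → ZFSet.{u} → ZFSet.{u} → Prop} {π σ γ p : ZFSet.{u}}

theorem memClause_mono
    (h : ∀ π' r q p, ZFSet.pair π' r ∈ γ → P.LE q p → S π' π q → T π' π q)
    (H : P.memClause S π γ p) : P.memClause T π γ p := by
  intro q hq
  obtain ⟨r, hr, π', s, hs, hrs, hS⟩ := H q hq
  exact ⟨r, hr, π', s, hs, hrs, h π' s r s hs hrs hS⟩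

theorem impClause_mono
    (h : ∀ π' r q p, ZFSet.pair π' r ∈ γ → P.LE q p → S π' π q → T π' π q)
    (h' : ∀ π' r q p, ZFSet.pair π' r ∈ σ → P.LE q p → T' π' π q → S' π' π q)
    (H : P.impClause S S' π σ γ p) : P.impClause T T' π σ γ p :=
  fun q hq hn => H q hq ⟨memClause_mono h' hn.1, fun r hr hm => hn.2 r hr (memClause_mono h hm)⟩

theorem eqClause_mono
    (h : ∀ π' π q, (∃ r, ZFSet.pair π' r ∈ σ ∨ ZFSet.pair π' r ∈ γ) →
      (∃ r, ZFSet.pair π r ∈ σ ∨ ZFSet.pair π r ∈ γ) → (∃ p, P.LE q p) → S π' π q → T π' π q)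
    (h' : ∀ π' π q, (∃ r, ZFSet.pair π' r ∈ σ ∨ ZFSet.pair π' r ∈ γ) →
      (∃ r, ZFSet.pair π r ∈ σ ∨ ZFSet.pair π r ∈ γ) → (∃ p, P.LE q p) → T' π' π q → S' π' π q)
    (H : P.eqClause S S' σ γ p) : P.eqClause T T' σ γ p := by
  intro π r hπ
  obtain ⟨h1, h2⟩ := H π r hπ
  exact ⟨impClause_mono (fun π' r q p hr hq => h π' π q ⟨r, .inr hr⟩ ⟨_, hπ⟩ ⟨p, hq⟩)
      (fun π' r q p hr hq => h' π' π q ⟨r, .inl hr⟩ ⟨_, hπ⟩ ⟨p, hq⟩) h1,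
    impClause_mono (fun π' r q p hr hq => h π' π q ⟨r, .inl hr⟩ ⟨_, hπ⟩ ⟨p, hq⟩)
      (fun π' r q p hr hq => h' π' π q ⟨r, .inr hr⟩ ⟨_, hπ⟩ ⟨p, hq⟩) h2⟩

end Mono

/-- The ternary relation coded by `X` (if `b` holds) or by its complement (otherwise). -/
def codedRel (X : ZFSet.{u}) (b : Prop) (σ γ p : ZFSet.{u}) : Prop :=
  ZFSet.pair p (ZFSet.pair σ γ) ∈ X ↔ b

namespace Ctx

variable {c : Ctx 𝓜 E} {p s t x y z X Y : E → ZFSet.{u}}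

theorem definable_memClause (hP : c.IsVar (fun _ => P.order)) (hX : c.IsVar X) (b : Prop)
    (hs : c.IsSetVar s) (ht : c.IsVar t) (hp : c.IsSetVar p) :
    c.Definable (fun e => P.memClause (codedRel (X e) b) (s e) (t e) (p e)) := by
  refine Definable.denseBelow hP hp (Definable.ex (Definable.ex ?_ ?_) ?_)
  · exact (definable_pair_mem isSetVar_top.up isSetVar_top ht.up.up.up.up).and
      ((definable_pair_mem isSetVar_top.up.up isSetVar_top hP.up.up.up.up).and
        ((definable_pair_pair_mem isSetVar_top.up.up isSetVar_top.up hs.up.up.up.up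
          hX.up.up.up.up).iff (Definable.const _ b)))
  · exact fun e r h => ht.right_mem h.1
  · rintro e π ⟨r, h, -⟩
    exact ht.left_mem h

theorem definable_impClause (hP : c.IsVar (fun _ => P.order)) (hX : c.IsVar X) (b : Prop)
    (hY : c.IsVar Y) (b' : Prop) (hz : c.IsSetVar z) (hs : c.IsVar s) (ht : c.IsVar t)
    (hp : c.IsSetVar p) :
    c.Definable (fun e => P.impClause (codedRel (X e) b) (codedRel (Y e) b')
      (z e) (s e) (t e) (p e)) :=
  Definable.starNot hP hp ((definable_memClause hP.up hY.up b' hz.up hs.up isSetVar_top).and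
    (Definable.starNot hP.up isSetVar_top
      (definable_memClause hP.up.up hX.up.up b hz.up.up ht.up.up isSetVar_top)))

theorem definable_eqClause (hP : c.IsVar (fun _ => P.order)) (hX : c.IsVar X) (b : Prop)
    (hY : c.IsVar Y) (b' : Prop) (hs : c.IsVar s) (ht : c.IsVar t) (hp : c.IsSetVar p) :
    c.Definable (fun e => P.eqClause (codedRel (X e) b) (codedRel (Y e) b')
      (s e) (t e) (p e)) := by
  refine Definable.all (Definable.all (Definable.imp ?_ ?_) ?_) ?_
  · exact (definable_pair_mem isSetVar_top.up isSetVar_top hs.up.up).or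
      (definable_pair_mem isSetVar_top.up isSetVar_top ht.up.up)
  · exact (definable_impClause hP.up.up hX.up.up b hY.up.up b' isSetVar_top.up hs.up.up ht.up.up
      hp.up.up).and (definable_impClause hP.up.up hX.up.up b hY.up.up b' isSetVar_top.up
        ht.up.up hs.up.up hp.up.up)
  · intro e r h
    rcases (Classical.not_imp.1 h).1 with h | h
    exacts [hs.right_mem h, ht.right_mem h]
  · intro e π h
    obtain ⟨r, h⟩ := not_forall.1 h
    rcases (Classical.not_imp.1 h).1 with h | h
    exacts [hs.left_mem h, ht.left_mem h]

/-- If `Q` is definable, then so is the set of codes of the triples that satisfy `Q`. -/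
theorem Definable.triple {Q : E → ZFSet.{u} → ZFSet.{u} → ZFSet.{u} → Prop} (hx : c.IsSetVar x)
    (h : c.pushSet.pushSet.pushSet.pushSet.Definable
      (fun e => Q e.1.1.1.1 e.1.2 e.2 e.1.1.1.2)) :
    c.Definable (fun e => ∃ p σ γ, x e = ZFSet.pair p (ZFSet.pair σ γ) ∧ Q e σ γ p) := by
  refine Definable.congr (Q := fun e => ∃ p w σ γ, (x e = ZFSet.pair p w ∧ w = ZFSet.pair σ γ) ∧
    Q e σ γ p) (Definable.ex (Definable.ex (Definable.ex (Definable.ex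
      (((definable_eq_pair hx.up.up.up.up isSetVar_top.up.up.up isSetVar_top.up.up).and
      (definable_eq_pair isSetVar_top.up.up isSetVar_top.up isSetVar_top)).and h) ?_) ?_) ?_) ?_)
      fun e => ?_
  · rintro e γ ⟨⟨-, h⟩, -⟩
    exact (c.isMK.pair_mem.1 (h ▸ e.1.2.2)).2
  · rintro e σ ⟨γ, ⟨-, h⟩, -⟩
    exact (c.isMK.pair_mem.1 (h ▸ e.2.2)).1
  · rintro e w ⟨σ, γ, ⟨h, -⟩, -⟩
    exact (c.isMK.pair_mem.1 (h ▸ hx.mem e.1)).2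
  · rintro e p ⟨w, σ, γ, ⟨h, -⟩, -⟩
    exact (c.isMK.pair_mem.1 (h ▸ hx.mem e)).1
  · constructor
    · rintro ⟨p, w, σ, γ, ⟨h, rfl⟩, hQ⟩
      exact ⟨p, σ, γ, h, hQ⟩
    · rintro ⟨p, σ, γ, h, hQ⟩
      exact ⟨p, _, σ, γ, ⟨h, rfl⟩, hQ⟩

end Ctx

/-- `U` codes the relation `p ⊩* σ = γ` for `σ, γ ∈ M`. -/
def CodesEq (𝓜 : ClassModel.{u}) (P : ForcingNotion.{u}) (U : ZFSet.{u}) : Prop :=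
  ∀ σ ∈ 𝓜.sets, ∀ γ ∈ 𝓜.sets, ∀ p ∈ 𝓜.sets,
    ZFSet.pair p (ZFSet.pair σ γ) ∈ U ↔ P.starAtom .eq σ γ p

theorem exists_codesEq (h𝓜 : 𝓜.IsMK) (hP : P.IsForcing 𝓜) :
    ∃ U ∈ 𝓜.classes, CodesEq 𝓜 P U := by
  obtain ⟨U, hU, V, hV, H⟩ := h𝓜.exists_fixed_pair hP.order_mem
    (Φ := fun X Y x => ∃ p σ γ, x = ZFSet.pair p (ZFSet.pair σ γ) ∧
      P.eqClause (codedRel X True) (codedRel Y False) σ γ p)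
    (Ψ := fun X Y x => ∃ p σ γ, x = ZFSet.pair p (ZFSet.pair σ γ) ∧
      ¬ P.eqClause (codedRel Y False) (codedRel X True) σ γ p)
    (by
      intro E c X Y x hP hX hY hx
      exact Definable.triple hx (definable_eqClause hP.up.up.up.up hX.up.up.up.up _
        hY.up.up.up.up _ isSetVar_top.up.isVar isSetVar_top.isVar isSetVar_top.up.up.up))
    (by
      intro E c X Y x hP hX hY hx
      exact Definable.triple hx (definable_eqClause hP.up.up.up.up hY.up.up.up.up _
        hX.up.up.up.up _ isSetVar_top.up.isVar isSetVar_top.isVar isSetVar_top.up.up.up).not)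
    (by
      rintro X Y X' Y' hX hY x ⟨p, σ, γ, rfl, h⟩
      refine ⟨p, σ, γ, rfl, eqClause_mono ?_ ?_ h⟩ <;> simp only [codedRel, iff_true, iff_false]
      · exact fun _ _ _ _ _ _ h => hX h
      · exact fun _ _ _ _ _ _ h h' => h (hY h'))
    (by
      rintro X Y X' Y' hX hY x ⟨p, σ, γ, rfl, h⟩
      refine ⟨p, σ, γ, rfl, mt (eqClause_mono ?_ ?_) h⟩ <;>
        simp only [codedRel, iff_true, iff_false]
      · exact fun _ _ _ _ _ _ h h' => h (hY h')
      · exact fun _ _ _ _ _ _ h => hX h)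
  refine ⟨U, hU, ?_⟩
  suffices h : ∀ α : Ordinal.{u}, ∀ σ ∈ 𝓜.sets, ∀ γ ∈ 𝓜.sets, max σ.rank γ.rank = α →
      ∀ p ∈ 𝓜.sets, (ZFSet.pair p (ZFSet.pair σ γ) ∈ U ↔ P.starAtom .eq σ γ p) ∧
        (ZFSet.pair p (ZFSet.pair σ γ) ∈ V ↔ ¬ P.starAtom .eq σ γ p) from
    fun σ hσ γ hγ p hp => (h _ σ hσ γ hγ rfl p hp).1
  intro α
  induction α using WellFoundedLT.induction with
  | ind α ih =>
    rintro σ hσ γ hγ rfl p hp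
    have dom : ∀ π, (∃ r, ZFSet.pair π r ∈ σ ∨ ZFSet.pair π r ∈ γ) →
        π ∈ 𝓜.sets ∧ π.rank < max σ.rank γ.rank := by
      rintro π ⟨r, h | h⟩
      · exact ⟨(h𝓜.pair_mem.1 (h𝓜.transitive _ hσ _ h)).1,
          lt_max_of_lt_left (rank_lt_of_pair_mem h)⟩
      · exact ⟨(h𝓜.pair_mem.1 (h𝓜.transitive _ hγ _ h)).1,
          lt_max_of_lt_right (rank_lt_of_pair_mem h)⟩
    have ih' : ∀ π' π q, (∃ r, ZFSet.pair π' r ∈ σ ∨ ZFSet.pair π' r ∈ γ) →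
        (∃ r, ZFSet.pair π r ∈ σ ∨ ZFSet.pair π r ∈ γ) → (∃ p, P.LE q p) →
        (codedRel U True π' π q ↔ P.starAtom .eq π' π q) ∧
          (codedRel V False π' π q ↔ P.starAtom .eq π' π q) := by
      rintro π' π q h' h ⟨p, hq⟩
      obtain ⟨h1, h2⟩ := ih _ (max_lt (dom π' h').2 (dom π h).2) π' (dom π' h').1 π (dom π h).1
        rfl q (h𝓜.classes_subset _ hP.conds_mem _ (hP.left_mem hq))
      simp [codedRel, h1, h2]
    have h1 : P.eqClause (codedRel U True) (codedRel V False) σ γ p ↔ P.starAtom .eq σ γ p := by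
      rw [starAtom_eq_iff_eqClause]
      exact ⟨eqClause_mono (fun _ _ _ h h' hq => (ih' _ _ _ h h' hq).1.1)
          (fun _ _ _ h h' hq => (ih' _ _ _ h h' hq).2.2),
        eqClause_mono (fun _ _ _ h h' hq => (ih' _ _ _ h h' hq).1.2)
          (fun _ _ _ h h' hq => (ih' _ _ _ h h' hq).2.1)⟩
    have h2 : P.eqClause (codedRel V False) (codedRel U True) σ γ p ↔ P.starAtom .eq σ γ p := by
      rw [starAtom_eq_iff_eqClause]
      exact ⟨eqClause_mono (fun _ _ _ h h' hq => (ih' _ _ _ h h' hq).2.1)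
          (fun _ _ _ h h' hq => (ih' _ _ _ h h' hq).1.2),
        eqClause_mono (fun _ _ _ h h' hq => (ih' _ _ _ h h' hq).2.2)
          (fun _ _ _ h h' hq => (ih' _ _ _ h h' hq).1.1)⟩
    obtain ⟨HU, HV⟩ := H _ (h𝓜.pair_mem.2 ⟨hp, h𝓜.pair_mem.2 ⟨hσ, hγ⟩⟩)
    rw [HU, HV, ← h1]
    simp only [ZFSet.pair_inj]
    refine ⟨⟨?_, fun h => ⟨p, σ, γ, ⟨rfl, rfl, rfl⟩, h⟩⟩, ?_,
      fun h => ⟨p, σ, γ, ⟨rfl, rfl, rfl⟩, ?_⟩⟩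
    · rintro ⟨_, _, _, ⟨rfl, rfl, rfl⟩, h⟩
      exact h
    · rintro ⟨_, _, _, ⟨rfl, rfl, rfl⟩, h⟩
      rwa [h1, ← h2]
    · rwa [h2, ← h1]

/-! ### Definability of the relation `⊩*` -/

section StarDefinable

variable {c : Ctx 𝓜 E} {p s t : E → ZFSet.{u}} {U N : ZFSet.{u}}

theorem definable_starAtom_eq (hU : CodesEq 𝓜 P U)
    (hcP : c.IsVar (fun _ => P.order)) (hcU : c.IsVar (fun _ => U))
    (hs : c.IsVar s) (ht : c.IsVar t) (hp : c.IsSetVar p) :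
    c.Definable (fun e => P.starAtom .eq (s e) (t e) (p e)) := by
  refine (definable_eqClause hcP hcU True hcU True hs ht hp).congr fun e => ?_
  rw [starAtom_eq_iff_eqClause]
  have dom : ∀ π, (∃ r, ZFSet.pair π r ∈ s e ∨ ZFSet.pair π r ∈ t e) → π ∈ 𝓜.sets := by
    rintro π ⟨r, h | h⟩
    exacts [hs.left_mem h, ht.left_mem h]
  have key : ∀ π' π q, (∃ r, ZFSet.pair π' r ∈ s e ∨ ZFSet.pair π' r ∈ t e) →
        (∃ r, ZFSet.pair π r ∈ s e ∨ ZFSet.pair π r ∈ t e) → (∃ p, P.LE q p) →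
        (codedRel U True π' π q ↔ P.starAtom .eq π' π q) := by
    rintro π' π q h' h ⟨p, hq⟩
    rw [codedRel, iff_true]
    exact hU π' (dom π' h') π (dom π h) q (hcP.left_mem (e := e) hq)
  exact ⟨eqClause_mono (fun _ _ _ h h' hq => (key _ _ _ h h' hq).1)
      (fun _ _ _ h h' hq => (key _ _ _ h h' hq).2),
    eqClause_mono (fun _ _ _ h h' hq => (key _ _ _ h h' hq).2)
      (fun _ _ _ h h' hq => (key _ _ _ h h' hq).1)⟩

theorem definable_starAtom_mem (hU : CodesEq 𝓜 P U)
    (hcP : c.IsVar (fun _ => P.order)) (hcU : c.IsVar (fun _ => U))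
    (hs : c.IsVar s) (ht : c.IsVar t) (hp : c.IsSetVar p) :
    c.Definable (fun e => P.starAtom .mem (s e) (t e) (p e)) := by
  simp only [starAtom_mem]
  refine Definable.denseBelow hcP hp (Definable.ex (Definable.ex ?_ ?_) ?_)
  · exact (definable_pair_mem isSetVar_top.up isSetVar_top ht.up.up.up.up).and
      ((definable_pair_mem isSetVar_top.up.up isSetVar_top hcP.up.up.up.up).and
        (definable_starAtom_eq hU hcP.up.up.up.up hcU.up.up.up.up isSetVar_top.up.isVar
          hs.up.up.up.up isSetVar_top.up.up))
  · exact fun e r h => ht.right_mem h.1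
  · rintro e π ⟨r, h, -⟩
    exact ht.left_mem h

theorem definable_all_classNames (hP : P.IsForcing 𝓜) (hcP : c.IsVar (fun _ => P.order))
    (hcN : c.IsVar (fun _ => N)) (hN : ∀ σ, σ ∈ N ↔ σ ∈ setNames 𝓜 P)
    {Q : E → ZFSet.{u} → Prop} (h : c.pushClass.Definable (fun e => Q e.1 e.2)) :
    c.Definable (fun e => ∀ Δ ∈ classNames 𝓜 P, Q e Δ) := by
  refine Definable.congr (Q := fun e => ∀ Δ : 𝓜.classes,
    (∀ x ∈ (Δ : ZFSet.{u}), ∃ τ ∈ N, ∃ p, P.LE p p ∧ x = ZFSet.pair τ p) → Q e Δ)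
    (Definable.allClass (Definable.imp ?_ h)) fun e => ?_
  · refine Definable.ball isVar_top (Definable.bex hcN.upc.up (Definable.ex
      ((definable_pair_mem isSetVar_top isSetVar_top hcP.upc.up.up.up).and
        (definable_eq_pair isSetVar_top.up.up isSetVar_top.up isSetVar_top)) ?_))
    rintro e p ⟨h, -⟩
    exact c.isMK.classes_subset _ hP.conds_mem _ (hP.left_mem h)
  · simp only [hN, ← hP.mem_conds_iff, Subtype.forall]
    exact ⟨fun H Δ hΔ => H Δ hΔ.1 hΔ.2, fun H Δ h h' => H Δ ⟨h, h'⟩⟩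

theorem definable_star (hP : P.IsForcing 𝓜) (hU : CodesEq 𝓜 P U)
    (hN : ∀ σ, σ ∈ N ↔ σ ∈ setNames 𝓜 P) {n m : ℕ} (φ : Formula n m) :
    ∀ {E : Type (u + 1)} {c : Ctx 𝓜 E} {p : E → ZFSet.{u}} (σ : E → Fin n → ZFSet.{u})
      (Γ : E → Fin m → ZFSet.{u}), c.IsVar (fun _ => P.order) → c.IsVar (fun _ => U) →
      c.IsVar (fun _ => N) → (∀ i, c.IsVar (fun e => σ e i)) → (∀ i, c.IsVar (fun e => Γ e i)) →
      c.IsSetVar p → c.Definable (fun e => P.Star 𝓜 φ (σ e) (Γ e) (p e)) := by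
  induction φ with
  | mem s t =>
    intro E c p σ Γ hcP hcU hcN hσ hΓ hp
    refine definable_starAtom_mem (s := fun e => Sum.elim (σ e) (Γ e) s)
      (t := fun e => Sum.elim (σ e) (Γ e) t) hU hcP hcU ?_ ?_ hp
    · cases s <;> simp [hσ, hΓ]
    · cases t <;> simp [hσ, hΓ]
  | eq s t =>
    intro E c p σ Γ hcP hcU hcN hσ hΓ hp
    refine definable_starAtom_eq (s := fun e => Sum.elim (σ e) (Γ e) s)
      (t := fun e => Sum.elim (σ e) (Γ e) t) hU hcP hcU ?_ ?_ hp
    · cases s <;> simp [hσ, hΓ]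
    · cases t <;> simp [hσ, hΓ]
  | neg φ ih =>
    intro E c p σ Γ hcP hcU hcN hσ hΓ hp
    exact Definable.starNot hcP hp (ih (fun e => σ e.1) (fun e => Γ e.1) hcP.up hcU.up
      hcN.up (fun i => (hσ i).up) (fun i => (hΓ i).up) isSetVar_top)
  | and φ ψ ihφ ihψ =>
    intro E c p σ Γ hcP hcU hcN hσ hΓ hp
    exact (ihφ σ Γ hcP hcU hcN hσ hΓ hp).and (ihψ σ Γ hcP hcU hcN hσ hΓ hp)
  | allSet φ ih =>
    intro E c p σ Γ hcP hcU hcN hσ hΓ hp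
    refine Definable.congr (Q := fun e => ∀ τ ∈ N,
      P.Star 𝓜 φ (Fin.cons τ (σ e)) (Γ e) (p e)) (Definable.ball hcN
        (ih (fun e => Fin.cons (e.2 : ZFSet.{u}) (σ e.1)) (fun e => Γ e.1)
          hcP.up hcU.up hcN.up ?_ (fun i => (hΓ i).up) hp.up))
      fun e => by simp only [hN]; rfl
    exact Fin.cases isSetVar_top.isVar fun i => (hσ i).up
  | allClass φ ih =>
    intro E c p σ Γ hcP hcU hcN hσ hΓ hp
    refine (definable_all_classNames hP hcP hcN hN (Q := fun e Δ =>
      P.Star 𝓜 φ (σ e) (Fin.cons Δ (Γ e)) (p e))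
        (ih (fun e => σ e.1) (fun e => Fin.cons (e.2 : ZFSet.{u}) (Γ e.1))
          hcP.upc hcU.upc hcN.upc (fun i => (hσ i).upc) ?_ hp.upc))
    exact Fin.cases isVar_top fun i => (hΓ i).upc

end StarDefinable

variable {G : ZFSet.{u}}

theorem ClassModel.IsMK.sets_subset_classes (h𝓜 : 𝓜.IsMK) {a : ZFSet.{u}} (ha : a ∈ 𝓜.sets) :
    a ∈ 𝓜.classes := by
  let c := Ctx.ofParams h𝓜 ![a] ![] (by simpa using ha) (by simp)
  have hc : c.IsVar (fun _ => a) := ⟨.inl (0 : Fin 1), rfl⟩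
  obtain ⟨Y, hY, H⟩ := Definable.exists_class (c := c) (Q := fun x => x ∈ a)
    (definable_mem isSetVar_top.isVar hc.up)
  have : Y = a := by
    ext x
    rw [H]
    exact ⟨fun h => h.2, fun h => ⟨h𝓜.transitive a ha x h, h⟩⟩
  exact this ▸ hY

/-- The sets of the model satisfying `D` form a class. -/
def IsClassPred (𝓜 : ClassModel.{u}) (D : ZFSet.{u} → Prop) : Prop :=
  ∃ Y ∈ 𝓜.classes, ∀ x, x ∈ Y ↔ x ∈ 𝓜.sets ∧ D x

/-! ### Generic filters -/

section Generic

variable {D : ZFSet.{u} → Prop} {p q : ZFSet.{u}}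

theorem ForcingNotion.IsGeneric.exists_mem_of_dense (hG : P.IsGeneric 𝓜 G) (h𝓜 : 𝓜.IsMK)
    (hP : P.IsForcing 𝓜) (hD : IsClassPred 𝓜 D)
    (dense : ∀ p ∈ P.conds, ∃ q, P.LE q p ∧ D q) : ∃ p ∈ G, D p := by
  obtain ⟨Y, hY, memY⟩ := hD
  let c := Ctx.ofParams h𝓜 ![] ![P.order, Y] (by simp)
    (by simp [Fin.forall_fin_succ, hP.order_mem, hY])
  have hcP : c.IsVar (fun _ => P.order) := ⟨.inr (0 : Fin 2), rfl⟩
  have hcY : c.IsVar (fun _ => Y) := ⟨.inr (1 : Fin 2), rfl⟩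
  obtain ⟨Z, hZ, memZ⟩ := Definable.exists_class (c := c) (Q := fun p => P.LE p p ∧ p ∈ Y)
    ((definable_pair_mem isSetVar_top isSetVar_top hcP.up).and
      (definable_mem isSetVar_top.isVar hcY.up))
  obtain ⟨p, hp, hpZ⟩ := hG.meets_dense Z hZ ⟨fun p hp => hP.left_mem ((memZ p).1 hp).2.1, by
    intro p hp
    obtain ⟨q, hq, hDq⟩ := dense p hp
    have hqP := hP.left_mem hq
    have hqM := h𝓜.classes_subset _ hP.conds_mem _ hqP
    exact ⟨q, (memZ q).2 ⟨hqM, hP.refl q hqP, (memY q).2 ⟨hqM, hDq⟩⟩, hq⟩⟩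
  exact ⟨p, hp, ((memY p).1 ((memZ p).1 hpZ).2.2).2⟩

theorem ForcingNotion.IsGeneric.exists_mem_of_denseBelow (hG : P.IsGeneric 𝓜 G) (h𝓜 : 𝓜.IsMK)
    (hP : P.IsForcing 𝓜) (hD : IsClassPred 𝓜 D) (hp : p ∈ G)
    (dense : P.DenseBelow {q | D q} p) : ∃ q ∈ G, P.LE q p ∧ D q := by
  have hpP := hG.subset hp
  have hpM := h𝓜.classes_subset _ hP.conds_mem _ hpP
  obtain ⟨Y, hY, memY⟩ := hD
  let c := Ctx.ofParams h𝓜 ![p] ![P.order, Y] (by simpa using hpM)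
    (by simp [Fin.forall_fin_succ, hP.order_mem, hY])
  have hcp : c.IsSetVar (fun _ => p) := ⟨(0 : Fin 1), rfl⟩
  have hcP : c.IsVar (fun _ => P.order) := ⟨.inr (0 : Fin 2), rfl⟩
  have hcY : c.IsVar (fun _ => Y) := ⟨.inr (1 : Fin 2), rfl⟩
  have hD' : IsClassPred 𝓜 fun q => (P.LE q p ∧ q ∈ Y) ∨ P.starNot (fun r => P.LE r p) q :=
    Definable.exists_class (c := c) (((definable_pair_mem isSetVar_top hcp.up hcP.up).and
      (definable_mem isSetVar_top.isVar hcY.up)).or (Definable.starNot hcP.up isSetVar_top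
        (definable_pair_mem isSetVar_top hcp.up.up hcP.up.up)))
  obtain ⟨q, hq, h | h⟩ := hG.exists_mem_of_dense h𝓜 hP hD' (by
    intro q hq
    by_cases h : P.starNot (fun r => P.LE r p) q
    · exact ⟨q, hP.refl q hq, .inr h⟩
    · simp only [ForcingNotion.starNot, not_forall, not_not] at h
      obtain ⟨r, hrq, hrp⟩ := h
      obtain ⟨s, hsr, hs⟩ := dense r hrp
      exact ⟨s, hP.trans _ _ _ hsr hrq, .inl ⟨hP.trans _ _ _ hsr hrp, (memY s).2
        ⟨h𝓜.classes_subset _ hP.conds_mem _ (hP.left_mem hsr), hs⟩⟩⟩)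
  · exact ⟨q, hq, h.1, ((memY q).1 h.2).2⟩
  · obtain ⟨r, -, hrq, hrp⟩ := hG.compatible q hq p hp
    exact (h r hrq hrp).elim

theorem ForcingNotion.IsGeneric.directed (hG : P.IsGeneric 𝓜 G) (h𝓜 : 𝓜.IsMK)
    (hP : P.IsForcing 𝓜) (hp : p ∈ G) (hq : q ∈ G) : ∃ r ∈ G, P.LE r p ∧ P.LE r q := by
  have hqM := h𝓜.classes_subset _ hP.conds_mem _ (hG.subset hq)
  let c := Ctx.ofParams h𝓜 ![q] ![P.order] (by simpa using hqM)
    (by simpa using hP.order_mem)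
  have hcq : c.IsSetVar (fun _ => q) := ⟨(0 : Fin 1), rfl⟩
  have hcP : c.IsVar (fun _ => P.order) := ⟨.inr (0 : Fin 1), rfl⟩
  have hD : IsClassPred 𝓜 fun r => P.LE r q ∨ P.starNot (fun s => P.LE s q) r :=
    Definable.exists_class (c := c) ((definable_pair_mem isSetVar_top hcq.up hcP.up).or
      (Definable.starNot hcP.up isSetVar_top
        (definable_pair_mem isSetVar_top hcq.up.up hcP.up.up)))
  obtain ⟨r, hr, hrp, h | h⟩ := hG.exists_mem_of_denseBelow h𝓜 hP hD hp (by
    intro r hr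
    by_cases h : P.starNot (fun s => P.LE s q) r
    · exact ⟨r, hP.refl r (hP.left_mem hr), .inr h⟩
    · simp only [ForcingNotion.starNot, not_forall, not_not] at h
      obtain ⟨s, hsr, hsq⟩ := h
      exact ⟨s, hsr, .inl hsq⟩)
  · exact ⟨r, hr, hrp, h⟩
  · obtain ⟨s, -, hsr, hsq⟩ := hG.compatible r hr q hq
    exact (h s hsr hsq).elim

theorem ForcingNotion.IsGeneric.starNot_iff (hG : P.IsGeneric 𝓜 G) (h𝓜 : 𝓜.IsMK)
    (hP : P.IsForcing 𝓜) (hD : IsClassPred 𝓜 D) (mono : ∀ p q, P.LE q p → D p → D q) :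
    (∃ p ∈ G, P.starNot D p) ↔ ¬ ∃ p ∈ G, D p := by
  constructor
  · rintro ⟨p, hp, hn⟩ ⟨q, hq, hD⟩
    obtain ⟨r, -, hrp, hrq⟩ := hG.compatible p hp q hq
    exact hn r hrp (mono q r hrq hD)
  · intro hn
    obtain ⟨Y, hY, memY⟩ := hD
    let c := Ctx.ofParams h𝓜 ![] ![P.order, Y] (by simp)
      (by simp [Fin.forall_fin_succ, hP.order_mem, hY])
    have hcP : c.IsVar (fun _ => P.order) := ⟨.inr (0 : Fin 2), rfl⟩
    have hcY : c.IsVar (fun _ => Y) := ⟨.inr (1 : Fin 2), rfl⟩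
    have hD' : IsClassPred 𝓜 fun p => p ∈ Y ∨ P.starNot (fun q => q ∈ Y) p :=
      Definable.exists_class (c := c) ((definable_mem isSetVar_top.isVar hcY.up).or
        (Definable.starNot hcP.up isSetVar_top (definable_mem isSetVar_top.isVar hcY.up.up)))
    obtain ⟨p, hp, h | h⟩ := hG.exists_mem_of_dense h𝓜 hP hD' (by
      intro p hp
      by_cases h : P.starNot (fun q => q ∈ Y) p
      · exact ⟨p, hP.refl p hp, .inr h⟩
      · simp only [ForcingNotion.starNot, not_forall, not_not] at h
        obtain ⟨q, hq, hqY⟩ := h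
        exact ⟨q, hq, .inl hqY⟩)
    · exact (hn ⟨p, hp, ((memY p).1 h).2⟩).elim
    · exact ⟨p, hp, fun q hq hDq => h q hq ((memY q).2
        ⟨h𝓜.classes_subset _ hP.conds_mem _ (hP.left_mem hq), hDq⟩)⟩

theorem ForcingNotion.IsGeneric.forall_iff (hG : P.IsGeneric 𝓜 G) (h𝓜 : 𝓜.IsMK)
    (hP : P.IsForcing 𝓜) {I : Set ZFSet.{u}} {A : ZFSet.{u} → ZFSet.{u} → Prop}
    (mono : ∀ τ p q, P.LE q p → A τ p → A τ q)
    (of_dense : ∀ τ p, P.DenseBelow {q | A τ q} p → A τ p)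
    (hD : IsClassPred 𝓜 fun p => (∀ τ ∈ I, A τ p) ∨ ¬ ∀ τ ∈ I, ¬ P.starNot (A τ) p) :
    (∃ p ∈ G, ∀ τ ∈ I, A τ p) ↔ ∀ τ ∈ I, ∃ p ∈ G, A τ p := by
  constructor
  · rintro ⟨p, hp, h⟩ τ hτ
    exact ⟨p, hp, h τ hτ⟩
  · intro H
    obtain ⟨p, hp, h | h⟩ := hG.exists_mem_of_dense h𝓜 hP hD (by
      intro p hp
      by_cases h : ∀ τ ∈ I, A τ p
      · exact ⟨p, hP.refl p hp, .inl h⟩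
      · simp only [not_forall] at h
        obtain ⟨τ, hτ, h⟩ := h
        have h' := mt (of_dense τ p) h
        simp only [ForcingNotion.DenseBelow, not_forall, not_exists, not_and] at h'
        obtain ⟨q, hq, h'⟩ := h'
        exact ⟨q, hq, .inr fun hn => hn τ hτ h'⟩)
    · exact ⟨p, hp, h⟩
    · simp only [not_forall, not_not] at h
      obtain ⟨τ, hτ, h⟩ := h
      obtain ⟨q, hq, hA⟩ := H τ hτ
      obtain ⟨r, -, hrp, hrq⟩ := hG.compatible p hp q hq
      exact (h r hrp (mono τ q r hrq hA)).elim

end Generic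

/-! ### Basic properties of `⊩*` -/

section Basic

variable {A : ZFSet.{u} → Prop} {p q σ γ : ZFSet.{u}}

theorem starNot_mono (hP : P.IsForcing 𝓜) (hq : P.LE q p) (h : P.starNot A p) :
    P.starNot A q :=
  fun r hr => h r (hP.trans _ _ _ hr hq)

theorem starNot_of_dense (hP : P.IsForcing 𝓜) (mono : ∀ p q, P.LE q p → A p → A q)
    (h : P.DenseBelow {q | P.starNot A q} p) : P.starNot A p := by
  intro q hq hA
  obtain ⟨r, hr, hn⟩ := h q hq
  exact hn r (hP.refl r (hP.left_mem hr)) (mono q r hr hA)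

theorem starAtom_mem_mono (hP : P.IsForcing 𝓜) (hq : P.LE q p) (h : P.starAtom .mem σ γ p) :
    P.starAtom .mem σ γ q := by
  rw [starAtom_mem] at h ⊢
  exact fun r hr => h r (hP.trans _ _ _ hr hq)

theorem starAtom_eq_mono (hP : P.IsForcing 𝓜) (hq : P.LE q p) (h : P.starAtom .eq σ γ p) :
    P.starAtom .eq σ γ q := by
  rw [starAtom_eq] at h ⊢
  exact fun π r hπ => ⟨starNot_mono hP hq (h π r hπ).1, starNot_mono hP hq (h π r hπ).2⟩

theorem starAtom_mem_of_dense (hP : P.IsForcing 𝓜)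
    (h : P.DenseBelow {q | P.starAtom .mem σ γ q} p) : P.starAtom .mem σ γ p := by
  rw [starAtom_mem]
  intro q hq
  obtain ⟨r, hr, hm⟩ := h q hq
  obtain ⟨s, hs, hs'⟩ := (starAtom_mem P σ γ r).1 hm r (hP.refl r (hP.left_mem hr))
  exact ⟨s, hP.trans _ _ _ hs hr, hs'⟩

theorem starAtom_eq_of_dense (hP : P.IsForcing 𝓜)
    (h : P.DenseBelow {q | P.starAtom .eq σ γ q} p) : P.starAtom .eq σ γ p := by
  rw [starAtom_eq]
  intro π r hπ
  have mono : ∀ σ γ p q, P.LE q p → (P.starAtom .mem π σ p ∧ P.starNot (P.starAtom .mem π γ) p) →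
      (P.starAtom .mem π σ q ∧ P.starNot (P.starAtom .mem π γ) q) := fun σ γ p q hq hp =>
    ⟨starAtom_mem_mono hP hq hp.1, starNot_mono hP hq hp.2⟩
  constructor
  · refine starNot_of_dense hP (mono σ γ) fun q hq => ?_
    obtain ⟨s, hs, hm⟩ := h q hq
    exact ⟨s, hs, ((starAtom_eq P σ γ s).1 hm π r hπ).1⟩
  · refine starNot_of_dense hP (mono γ σ) fun q hq => ?_
    obtain ⟨s, hs, hm⟩ := h q hq
    exact ⟨s, hs, ((starAtom_eq P σ γ s).1 hm π r hπ).2⟩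

theorem star_mono (hP : P.IsForcing 𝓜) {n m : ℕ} (φ : Formula n m) (σ : Fin n → ZFSet.{u})
    (Γ : Fin m → ZFSet.{u}) (p q : ZFSet.{u}) (hq : P.LE q p) (h : P.Star 𝓜 φ σ Γ p) :
    P.Star 𝓜 φ σ Γ q := by
  induction φ with
  | mem s t => exact starAtom_mem_mono hP hq h
  | eq s t => exact starAtom_eq_mono hP hq h
  | neg φ _ => exact starNot_mono hP hq h
  | and φ ψ ihφ ihψ => exact ⟨ihφ σ Γ h.1, ihψ σ Γ h.2⟩
  | allSet φ ih => exact fun τ hτ => ih _ Γ (h τ hτ)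
  | allClass φ ih => exact fun Δ hΔ => ih σ _ (h Δ hΔ)

theorem star_of_dense (hP : P.IsForcing 𝓜) {n m : ℕ} (φ : Formula n m) (σ : Fin n → ZFSet.{u})
    (Γ : Fin m → ZFSet.{u}) (p : ZFSet.{u}) (h : P.DenseBelow {q | P.Star 𝓜 φ σ Γ q} p) :
    P.Star 𝓜 φ σ Γ p := by
  induction φ with
  | mem s t => exact starAtom_mem_of_dense hP h
  | eq s t => exact starAtom_eq_of_dense hP h
  | neg φ _ => exact starNot_of_dense hP (star_mono hP φ σ Γ) h
  | and φ ψ ihφ ihψ =>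
    exact ⟨ihφ σ Γ fun q hq => (h q hq).imp fun r hr => ⟨hr.1, hr.2.1⟩,
      ihψ σ Γ fun q hq => (h q hq).imp fun r hr => ⟨hr.1, hr.2.2⟩⟩
  | allSet φ ih =>
    exact fun τ hτ => ih _ Γ fun q hq => (h q hq).imp fun r hr => ⟨hr.1, hr.2 τ hτ⟩
  | allClass φ ih =>
    exact fun Δ hΔ => ih σ _ fun q hq => (h q hq).imp fun r hr => ⟨hr.1, hr.2 Δ hΔ⟩

end Basic

/-! ### The Truth Lemma -/

section Truth

variable {σ γ U : ZFSet.{u}}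

theorem isClassPred_starAtom_mem (h𝓜 : 𝓜.IsMK) (hP : P.IsForcing 𝓜) (hU : U ∈ 𝓜.classes)
    (hUeq : CodesEq 𝓜 P U) (hσ : σ ∈ 𝓜.classes) (hγ : γ ∈ 𝓜.classes) :
    IsClassPred 𝓜 (P.starAtom .mem σ γ) := by
  let c := Ctx.ofParams h𝓜 ![] ![P.order, U, σ, γ] (by simp)
    (by simp [Fin.forall_fin_succ, hP.order_mem, hU, hσ, hγ])
  have hcP : c.IsVar (fun _ => P.order) := ⟨.inr (0 : Fin 4), rfl⟩
  have hcU : c.IsVar (fun _ => U) := ⟨.inr (1 : Fin 4), rfl⟩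
  have hcσ : c.IsVar (fun _ => σ) := ⟨.inr (2 : Fin 4), rfl⟩
  have hcγ : c.IsVar (fun _ => γ) := ⟨.inr (3 : Fin 4), rfl⟩
  exact Definable.exists_class (c := c)
    (definable_starAtom_mem hUeq hcP.up hcU.up hcσ.up hcγ.up isSetVar_top)

theorem truth_mem (h𝓜 : 𝓜.IsMK) (hP : P.IsForcing 𝓜) (hG : P.IsGeneric 𝓜 G)
    (hU : U ∈ 𝓜.classes) (hUeq : CodesEq 𝓜 P U) (hσ : σ ∈ 𝓜.classes) (hγ : γ ∈ 𝓜.classes)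
    (heq : ∀ π r, ZFSet.pair π r ∈ γ →
      (interp G π = interp G σ ↔ ∃ p ∈ G, P.starAtom .eq π σ p)) :
    interp G σ ∈ interp G γ ↔ ∃ p ∈ G, P.starAtom .mem σ γ p := by
  rw [mem_interp]
  constructor
  · rintro ⟨π, r, hr, hπ, h⟩
    obtain ⟨q, hq, hqeq⟩ := (heq π r hπ).1 h
    obtain ⟨p, hp, hpr, hpq⟩ := hG.directed h𝓜 hP hr hq
    refine ⟨p, hp, (starAtom_mem ..).2 fun s hs => ⟨s, hP.refl s (hP.left_mem hs), π, r, hπ,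
      hP.trans _ _ _ hs hpr, starAtom_eq_mono hP (hP.trans _ _ _ hs hpq) hqeq⟩⟩
  · rintro ⟨p, hp, hm⟩
    let c := Ctx.ofParams h𝓜 ![] ![P.order, U, σ, γ] (by simp)
      (by simp [Fin.forall_fin_succ, hP.order_mem, hU, hσ, hγ])
    have hcP : c.IsVar (fun _ => P.order) := ⟨.inr (0 : Fin 4), rfl⟩
    have hcU : c.IsVar (fun _ => U) := ⟨.inr (1 : Fin 4), rfl⟩
    have hcσ : c.IsVar (fun _ => σ) := ⟨.inr (2 : Fin 4), rfl⟩
    have hcγ : c.IsVar (fun _ => γ) := ⟨.inr (3 : Fin 4), rfl⟩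
    have hD : IsClassPred 𝓜 fun q => ∃ π r, ZFSet.pair π r ∈ γ ∧ P.LE q r ∧
        P.starAtom .eq π σ q := by
      refine Definable.exists_class (c := c) (Definable.ex (Definable.ex ?_ ?_) ?_)
      · exact (definable_pair_mem isSetVar_top.up isSetVar_top hcγ.up.up.up).and
          ((definable_pair_mem isSetVar_top.up.up isSetVar_top hcP.up.up.up).and
            (definable_starAtom_eq hUeq hcP.up.up.up hcU.up.up.up isSetVar_top.up.isVar
              hcσ.up.up.up isSetVar_top.up.up))
      · exact fun e r h => hcγ.right_mem (e := ⟨⟩) h.1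
      · rintro e π ⟨r, h, -⟩
        exact hcγ.left_mem (e := ⟨⟩) h
    obtain ⟨q, hq, -, π, r, hπ, hqr, hqeq⟩ :=
      hG.exists_mem_of_denseBelow h𝓜 hP hD hp ((starAtom_mem ..).1 hm)
    exact ⟨π, r, hG.upward_closed q hq r hqr, hπ, (heq π r hπ).2 ⟨q, hq, hqeq⟩⟩

theorem interp_subset_of_starNot (h𝓜 : 𝓜.IsMK) (hP : P.IsForcing 𝓜) (hG : P.IsGeneric 𝓜 G)
    (hU : U ∈ 𝓜.classes) (hUeq : CodesEq 𝓜 P U) (hσ : σ ∈ 𝓜.classes) (hγ : γ ∈ 𝓜.classes)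
    (hmem : ∀ π r, ZFSet.pair π r ∈ σ →
      (interp G π ∈ interp G σ → ∃ p ∈ G, P.starAtom .mem π σ p) ∧
      ((∃ p ∈ G, P.starAtom .mem π γ p) → interp G π ∈ interp G γ))
    {p : ZFSet.{u}} (hp : p ∈ G)
    (h : ∀ π r, ZFSet.pair π r ∈ σ → P.starNot (fun q => P.starAtom .mem π σ q ∧
      P.starNot (P.starAtom .mem π γ) q) p) :
    interp G σ ⊆ interp G γ := by
  intro y hy
  obtain ⟨π, r, hr, hπ, rfl⟩ := mem_interp.1 hy
  obtain ⟨q, hq, hqm⟩ := (hmem π r hπ).1 hy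
  obtain ⟨s, hs, hsp, hsq⟩ := hG.directed h𝓜 hP hp hq
  have hπC : π ∈ 𝓜.classes :=
    h𝓜.sets_subset_classes (h𝓜.pair_mem.1 (h𝓜.classes_subset _ hσ _ hπ)).1
  obtain ⟨u, hu, -, hum⟩ := hG.exists_mem_of_denseBelow h𝓜 hP
    (isClassPred_starAtom_mem h𝓜 hP hU hUeq hπC hγ) hs (by
      intro t ht
      by_contra hn
      simp only [not_exists, not_and] at hn
      exact h π r hπ t (hP.trans _ _ _ ht hsp)
        ⟨starAtom_mem_mono hP (hP.trans _ _ _ ht hsq) hqm, hn⟩)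
  exact (hmem π r hπ).2 ⟨u, hu, hum⟩

theorem truth_eq (h𝓜 : 𝓜.IsMK) (hP : P.IsForcing 𝓜) (hG : P.IsGeneric 𝓜 G)
    (hU : U ∈ 𝓜.classes) (hUeq : CodesEq 𝓜 P U) (hσ : σ ∈ 𝓜.classes) (hγ : γ ∈ 𝓜.classes) :
    interp G σ = interp G γ ↔ ∃ p ∈ G, P.starAtom .eq σ γ p := by
  obtain ⟨α, hα⟩ : ∃ α, max σ.rank γ.rank = α := ⟨_, rfl⟩
  induction α using WellFoundedLT.induction generalizing σ γ with
  | ind α ih =>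
    subst hα
    have dom : ∀ π r, (ZFSet.pair π r ∈ σ ∨ ZFSet.pair π r ∈ γ) →
        π ∈ 𝓜.classes ∧ π.rank < max σ.rank γ.rank := by
      rintro π r (h | h)
      · exact ⟨h𝓜.sets_subset_classes (h𝓜.pair_mem.1 (h𝓜.classes_subset _ hσ _ h)).1,
          lt_max_of_lt_left (rank_lt_of_pair_mem h)⟩
      · exact ⟨h𝓜.sets_subset_classes (h𝓜.pair_mem.1 (h𝓜.classes_subset _ hγ _ h)).1,
          lt_max_of_lt_right (rank_lt_of_pair_mem h)⟩
    have eq_dom : ∀ π r, (ZFSet.pair π r ∈ σ ∨ ZFSet.pair π r ∈ γ) → ∀ π' r',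
        (ZFSet.pair π' r' ∈ σ ∨ ZFSet.pair π' r' ∈ γ) →
        (interp G π' = interp G π ↔ ∃ p ∈ G, P.starAtom .eq π' π p) := fun π r h π' r' h' =>
      ih _ (max_lt (dom π' r' h').2 (dom π r h).2) (dom π' r' h').1 (dom π r h).1 rfl
    have memσ : ∀ π r, (ZFSet.pair π r ∈ σ ∨ ZFSet.pair π r ∈ γ) →
        (interp G π ∈ interp G σ ↔ ∃ p ∈ G, P.starAtom .mem π σ p) := fun π r h =>
      truth_mem h𝓜 hP hG hU hUeq (dom π r h).1 hσ fun π' r' h' =>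
        eq_dom π r h π' r' (.inl h')
    have memγ : ∀ π r, (ZFSet.pair π r ∈ σ ∨ ZFSet.pair π r ∈ γ) →
        (interp G π ∈ interp G γ ↔ ∃ p ∈ G, P.starAtom .mem π γ p) := fun π r h =>
      truth_mem h𝓜 hP hG hU hUeq (dom π r h).1 hγ fun π' r' h' =>
        eq_dom π r h π' r' (.inr h')
    constructor
    · intro heq
      let c := Ctx.ofParams h𝓜 ![] ![P.order, U, σ, γ] (by simp)
        (by simp [Fin.forall_fin_succ, hP.order_mem, hU, hσ, hγ])
      have hcP : c.IsVar (fun _ => P.order) := ⟨.inr (0 : Fin 4), rfl⟩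
      have hcU : c.IsVar (fun _ => U) := ⟨.inr (1 : Fin 4), rfl⟩
      have hcσ : c.IsVar (fun _ => σ) := ⟨.inr (2 : Fin 4), rfl⟩
      have hcγ : c.IsVar (fun _ => γ) := ⟨.inr (3 : Fin 4), rfl⟩
      have hD : IsClassPred 𝓜 fun p => P.starAtom .eq σ γ p ∨
          ∃ π r, (ZFSet.pair π r ∈ σ ∨ ZFSet.pair π r ∈ γ) ∧
            ((P.starAtom .mem π σ p ∧ P.starNot (P.starAtom .mem π γ) p) ∨
              (P.starAtom .mem π γ p ∧ P.starNot (P.starAtom .mem π σ) p)) := by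
        refine Definable.exists_class (c := c) ((definable_starAtom_eq hUeq hcP.up hcU.up
          hcσ.up hcγ.up isSetVar_top).or (Definable.ex (Definable.ex
            (((definable_pair_mem isSetVar_top.up isSetVar_top hcσ.up.up.up).or
              (definable_pair_mem isSetVar_top.up isSetVar_top hcγ.up.up.up)).and
              (Definable.or ?_ ?_)) ?_) ?_))
        · exact (definable_starAtom_mem hUeq hcP.up.up.up hcU.up.up.up isSetVar_top.up.isVar
            hcσ.up.up.up isSetVar_top.up.up).and (Definable.starNot hcP.up.up.up
              isSetVar_top.up.up (definable_starAtom_mem hUeq hcP.up.up.up.up hcU.up.up.up.up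
                isSetVar_top.up.up.isVar hcγ.up.up.up.up isSetVar_top))
        · exact (definable_starAtom_mem hUeq hcP.up.up.up hcU.up.up.up isSetVar_top.up.isVar
            hcγ.up.up.up isSetVar_top.up.up).and (Definable.starNot hcP.up.up.up
              isSetVar_top.up.up (definable_starAtom_mem hUeq hcP.up.up.up.up hcU.up.up.up.up
                isSetVar_top.up.up.isVar hcσ.up.up.up.up isSetVar_top))
        · rintro e r ⟨h | h, -⟩
          exacts [hcσ.right_mem (e := ⟨⟩) h, hcγ.right_mem (e := ⟨⟩) h]
        · rintro e π ⟨r, h | h, -⟩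
          exacts [hcσ.left_mem (e := ⟨⟩) h, hcγ.left_mem (e := ⟨⟩) h]
      obtain ⟨p, hp, h | ⟨π, r, hπ, h⟩⟩ := hG.exists_mem_of_dense h𝓜 hP hD (by
        intro p hp
        by_cases h : P.starAtom .eq σ γ p
        · exact ⟨p, hP.refl p hp, .inl h⟩
        · rw [starAtom_eq] at h
          simp only [not_forall, ForcingNotion.starIff, not_and_or] at h
          obtain ⟨π, r, hπ, h⟩ := h
          rw [ZFSet.mem_union] at hπ
          rcases h with h | h
          · rw [ForcingNotion.starNot] at h
            simp only [not_forall, not_not] at h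
            obtain ⟨q, hq, h⟩ := h
            exact ⟨q, hq, .inr ⟨π, r, hπ, .inl h⟩⟩
          · rw [ForcingNotion.starNot] at h
            simp only [not_forall, not_not] at h
            obtain ⟨q, hq, h⟩ := h
            exact ⟨q, hq, .inr ⟨π, r, hπ, .inr h⟩⟩)
      · exact ⟨p, hp, h⟩
      · exfalso
        rcases h with ⟨h1, h2⟩ | ⟨h1, h2⟩
        · obtain ⟨q, hq, h3⟩ := (memγ π r hπ).1 (heq ▸ (memσ π r hπ).2 ⟨p, hp, h1⟩)
          obtain ⟨s, -, hsp, hsq⟩ := hG.compatible p hp q hq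
          exact h2 s hsp (starAtom_mem_mono hP hsq h3)
        · obtain ⟨q, hq, h3⟩ := (memσ π r hπ).1 (heq ▸ (memγ π r hπ).2 ⟨p, hp, h1⟩)
          obtain ⟨s, -, hsp, hsq⟩ := hG.compatible p hp q hq
          exact h2 s hsp (starAtom_mem_mono hP hsq h3)
    · rintro ⟨p, hp, h⟩
      rw [starAtom_eq] at h
      refine subset_antisymm ?_ ?_
      · exact interp_subset_of_starNot h𝓜 hP hG hU hUeq hσ hγ
          (fun π r hπ => ⟨(memσ π r (.inl hπ)).1, (memγ π r (.inl hπ)).2⟩) hp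
          (fun π r hπ => (h π r (ZFSet.mem_union.2 (.inl hπ))).1)
      · exact interp_subset_of_starNot h𝓜 hP hG hU hUeq hγ hσ
          (fun π r hπ => ⟨(memγ π r (.inr hπ)).1, (memσ π r (.inr hπ)).2⟩) hp
          (fun π r hπ => (h π r (ZFSet.mem_union.2 (.inr hπ))).2)

/-- All names, the order, a class coding `p ⊩* σ = γ` and the class of set-names can be used as
parameters. -/
theorem exists_ctx (h𝓜 : 𝓜.IsMK) (hP : P.IsForcing 𝓜) (hU : U ∈ 𝓜.classes) {N : ZFSet.{u}}
    (hN : N ∈ 𝓜.classes) {n m : ℕ}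
    (σ : Fin n → ZFSet.{u}) (hσ : ∀ i, σ i ∈ setNames 𝓜 P)
    (Γ : Fin m → ZFSet.{u}) (hΓ : ∀ i, Γ i ∈ classNames 𝓜 P) :
    ∃ c : Ctx 𝓜 PUnit.{u + 2}, c.IsVar (fun _ => P.order) ∧ c.IsVar (fun _ => U) ∧
      c.IsVar (fun _ => N) ∧ (∀ i, c.IsVar (fun _ => σ i)) ∧ ∀ i, c.IsVar (fun _ => Γ i) := by
  refine ⟨Ctx.ofParams h𝓜 σ
    (Fin.cons P.order (Fin.cons U (Fin.cons N Γ)) : Fin (m + 3) → ZFSet.{u})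
    (fun i => setNames_subset_sets (hσ i)) ?_, ⟨.inr (0 : Fin (m + 3)), rfl⟩,
    ⟨.inr (1 : Fin (m + 3)), rfl⟩, ⟨.inr (2 : Fin (m + 3)), rfl⟩, fun i => ⟨.inl i, rfl⟩,
    fun i => ⟨.inr (i.succ.succ.succ : Fin (m + 3)), rfl⟩⟩
  exact Fin.cases hP.order_mem (Fin.cases hU (Fin.cases hN fun i => (hΓ i).1))

theorem truth_lemma (h𝓜 : 𝓜.IsMK) (hP : P.IsForcing 𝓜) (hG : P.IsGeneric 𝓜 G)
    {n m : ℕ} (φ : Formula n m)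
    (σ : Fin n → ZFSet.{u}) (hσ : ∀ i, σ i ∈ setNames 𝓜 P)
    (Γ : Fin m → ZFSet.{u}) (hΓ : ∀ i, Γ i ∈ classNames 𝓜 P) :
    (extension 𝓜 P G).Sat φ (fun i => interp G (σ i)) (fun i => interp G (Γ i)) ↔
      ∃ p ∈ G, P.Star 𝓜 φ σ Γ p := by
  obtain ⟨U, hU, hUeq⟩ := exists_codesEq h𝓜 hP
  obtain ⟨N, hN, memN⟩ := exists_class_setNames h𝓜 hP
  have elim_mem : ∀ {n m : ℕ} (σ : Fin n → ZFSet.{u}) (_ : ∀ i, σ i ∈ setNames 𝓜 P)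
      (Γ : Fin m → ZFSet.{u}) (_ : ∀ i, Γ i ∈ classNames 𝓜 P) (s : Fin n ⊕ Fin m),
      Sum.elim σ Γ s ∈ 𝓜.classes := by
    rintro n m σ hσ Γ hΓ (i | i)
    exacts [h𝓜.sets_subset_classes (setNames_subset_sets (hσ i)), (hΓ i).1]
  have elim_interp : ∀ {n m : ℕ} (σ : Fin n → ZFSet.{u}) (Γ : Fin m → ZFSet.{u})
      (s : Fin n ⊕ Fin m), Sum.elim (fun i => interp G (σ i)) (fun i => interp G (Γ i)) s =
        interp G (Sum.elim σ Γ s) := by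
    rintro n m σ Γ (i | i) <;> rfl
  have interp_cons : ∀ {n : ℕ} (τ : ZFSet.{u}) (σ : Fin n → ZFSet.{u}),
      (Fin.cons (interp G τ) fun i => interp G (σ i) : Fin (n + 1) → ZFSet.{u}) =
        fun i => interp G ((Fin.cons τ σ : Fin (n + 1) → ZFSet.{u}) i) := by
    intro n τ σ
    funext i
    cases i using Fin.cases <;> rfl
  induction φ with
  | mem s t =>
    simp only [ClassModel.Sat, elim_interp]
    exact truth_mem h𝓜 hP hG hU hUeq (elim_mem σ hσ Γ hΓ s) (elim_mem σ hσ Γ hΓ t)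
      fun π r hπ => truth_eq h𝓜 hP hG hU hUeq (h𝓜.sets_subset_classes (h𝓜.pair_mem.1
        (h𝓜.classes_subset _ (elim_mem σ hσ Γ hΓ t) _ hπ)).1) (elim_mem σ hσ Γ hΓ s)
  | eq s t =>
    simp only [ClassModel.Sat, elim_interp]
    exact truth_eq h𝓜 hP hG hU hUeq (elim_mem σ hσ Γ hΓ s) (elim_mem σ hσ Γ hΓ t)
  | neg φ ih =>
    obtain ⟨c, hcP, hcU, hcN, hcσ, hcΓ⟩ := exists_ctx h𝓜 hP hU hN σ hσ Γ hΓ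
    exact (not_congr (ih σ hσ Γ hΓ)).trans (hG.starNot_iff h𝓜 hP (Definable.exists_class
      (definable_star hP hUeq memN φ (fun _ => σ) (fun _ => Γ) hcP.up hcU.up hcN.up
        (fun i => (hcσ i).up) (fun i => (hcΓ i).up) isSetVar_top)) (star_mono hP φ σ Γ)).symm
  | and φ ψ ihφ ihψ =>
    refine (and_congr (ihφ σ hσ Γ hΓ) (ihψ σ hσ Γ hΓ)).trans ⟨?_, ?_⟩
    · rintro ⟨⟨p, hp, hφ⟩, q, hq, hψ⟩
      obtain ⟨r, hr, hrp, hrq⟩ := hG.directed h𝓜 hP hp hq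
      exact ⟨r, hr, star_mono hP φ σ Γ p r hrp hφ, star_mono hP ψ σ Γ q r hrq hψ⟩
    · rintro ⟨p, hp, hφ, hψ⟩
      exact ⟨⟨p, hp, hφ⟩, p, hp, hψ⟩
  | allSet φ ih =>
    have key := hG.forall_iff h𝓜 hP (I := setNames 𝓜 P)
      (A := fun τ => P.Star 𝓜 φ (Fin.cons τ σ) Γ) (fun τ => star_mono hP φ _ Γ)
      (fun τ => star_of_dense hP φ _ Γ) (by
        obtain ⟨c, hcP, hcU, hcN, hcσ, hcΓ⟩ := exists_ctx h𝓜 hP hU hN σ hσ Γ hΓ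
        refine Definable.exists_class (c := c) (Definable.or (definable_star hP hUeq memN
          (.allSet φ) (fun _ => σ) (fun _ => Γ) hcP.up hcU.up hcN.up (fun i => (hcσ i).up)
          (fun i => (hcΓ i).up) isSetVar_top) ?_)
        simp only [← memN]
        refine (Definable.ball hcN.up (Definable.not (definable_star hP hUeq memN (.neg φ)
          (fun e => Fin.cons (e.2 : ZFSet.{u}) σ) (fun _ => Γ) hcP.up.up hcU.up.up hcN.up.up
          (Fin.cases isSetVar_top.isVar fun i => (hcσ i).up.up) (fun i => (hcΓ i).up.up)
          isSetVar_top.up))).not)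
    refine Iff.trans ?_ key.symm
    simp only [ClassModel.Sat, extension, Set.forall_mem_image, interp_cons]
    exact forall₂_congr fun τ hτ => ih _ (Fin.cases hτ hσ) Γ hΓ
  | allClass φ ih =>
    have key := hG.forall_iff h𝓜 hP (I := classNames 𝓜 P)
      (A := fun Δ => P.Star 𝓜 φ σ (Fin.cons Δ Γ)) (fun Δ => star_mono hP φ σ _)
      (fun Δ => star_of_dense hP φ σ _) (by
        obtain ⟨c, hcP, hcU, hcN, hcσ, hcΓ⟩ := exists_ctx h𝓜 hP hU hN σ hσ Γ hΓ
        refine Definable.exists_class (c := c) (Definable.or (definable_star hP hUeq memN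
          (.allClass φ) (fun _ => σ) (fun _ => Γ) hcP.up hcU.up hcN.up (fun i => (hcσ i).up)
          (fun i => (hcΓ i).up) isSetVar_top) ?_)
        refine (definable_all_classNames hP hcP.up hcN.up memN (Definable.not (definable_star hP
          hUeq memN (.neg φ) (fun _ => σ) (fun e => Fin.cons (e.2 : ZFSet.{u}) Γ) hcP.up.upc
          hcU.up.upc hcN.up.upc (fun i => (hcσ i).up.upc)
          (Fin.cases isVar_top fun i => (hcΓ i).up.upc) isSetVar_top.upc))).not)
    refine Iff.trans ?_ key.symm
    simp only [ClassModel.Sat, extension, Set.forall_mem_image, interp_cons]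
    exact forall₂_congr fun Δ hΔ => ih σ hσ _ (Fin.cases hΔ hΓ)

end Truth

end MKForcing

theorem lemma18 (𝓜 : MKForcing.ClassModel) (h𝓜 : 𝓜.IsMK)
    (P : MKForcing.ForcingNotion) (hP : P.IsForcing 𝓜)
    (G : ZFSet) (hG : P.IsGeneric 𝓜 G)
    {n m : ℕ} (φ : MKForcing.Formula n m)
    (σ : Fin n → ZFSet) (hσ : ∀ i, σ i ∈ MKForcing.setNames 𝓜 P)
    (Γ : Fin m → ZFSet) (hΓ : ∀ i, Γ i ∈ MKForcing.classNames 𝓜 P) :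
    (MKForcing.extension 𝓜 P G).Sat φ
        (fun i => MKForcing.interp G (σ i)) (fun i => MKForcing.interp G (Γ i)) ↔
      ∃ p ∈ G, P.Star 𝓜 φ σ Γ p :=
  MKForcing.truth_lemma h𝓜 hP hG φ σ hσ Γ hΓ
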